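/- **Setting.** A function is a *proper time change* on an interval if it is continuous and strictly increasing there; call it *regular* if moreover it is differentiable with positive derivative. (Derivatives at an end point belonging to the interval are one-sided.) Consider two SDEs in $\mathbb R^D$, $$dX_t=f(X_t,t)\,dt+g(t)\,dW_t\quad (t\in I),\qquad dY_s=\tilde f(Y_s,s)\,ds+\tilde g(s)\,dW_s\quad (s\in \tilde I),$$ started at time $0$, where $I,\tilde I$ are intervals of positive times of the form $(0,T)$, $(0,T]$ or $(0,\infty)$. They are *equivalent up to the time change* $\phi:t\mapsto s$ if $\phi$ is a proper time change of $I$ onto $\tilde I$, differentiable on $I$, with $\dot\phi(t)\tilde f(x,\phi(t))=f(x,t)$ and $\sqrt{\dot\phi(t)}\,\tilde g(\phi(t))=g(t)$ for all $x\in\mathbb R^D$, $t\in I$. For a regular time change $\Phi$ on $I$, the first SDE *written in the time* $h=\Phi(t)$ has drift $f(x,\Phi^{-1}(h))/\dot\Phi(\Phi^{-1}(h))$ and volatility $g(\Phi^{-1}(h))/\sqrt{\dot\Phi(\Phi^{-1}(h))}$ on the interval $\Phi(I)$, and similarly for the second SDE. Assume that the two SDEs are equivalent up to the time change $\phi$.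 Let $p_0$ be a probability measure on $\mathbb R^D$ (the data distribution), and let $X$, $Y$ be weak solutions of the two SDEs with $X_0\sim p_0$ and $Y_0\sim p_0$. Conditional entropies $\mathbf H[x_0|x_t]=-\mathbb E\log p(x_0|x_t)$ are formed with conditional densities with respect to a $\sigma$-finite reference measure (for example Lebesgue measure for continuous data, or counting measure on a countable set for discrete data). Assume that $\mathbf H[X_0|X_t]$ is well defined and finite for every $t\in I$, i.e. the conditional density exists and $\log p(x_0|x_t)$ is integrable. Write $\Phi_t:t\mapsto\mathbf H[X_0|X_t]$ on $I$ and $\Phi_s:s\mapsto\mathbf H[Y_0|Y_s]$ on $\tilde I$ for the *entropic times*, and $$F:=\Phi_s\circ\phi\circ\Phi_t^{-1}.$$ **Theorem.** 1. *(General drift and volatility.)* Suppose that the first SDE with initial law $p_0$ determines its forward kernel, i.e. the law of $(X_t,X_0)$ is the same for all weak solutions, for each $t\in I$. Then $\mathbf H[Y_0|Y_{\phi(t)}]$ is well defined and finite and $\mathbf H[Y_0|Y_{\phi(t)}]=\mathbf H[X_0|X_t]$ for all $t\in I$. If $\Phi_t$ is a proper time change, then so is $\Phi_s$, and $F$ is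 a proper time change of $\Phi_t(I)$ onto $\Phi_s(\tilde I)$ with $F=\mathrm{id}$. If $\Phi_t$ and $\Phi_s$ are regular time changes, then the two SDEs written in their respective entropic times are equivalent up to the time change $F$, and they coincide: same time interval, same drift, same volatility. 2. *(Scale and noise schedules.)* Suppose that the two SDEs are of the form $$dX_t=\frac{\dot s(t)}{s(t)}X_t\,dt+s(t)\sqrt{2\dot\sigma(t)\sigma(t)}\,dW_t,$$ for schedules $(s,\sigma)$ on $I$ and $(\tilde s,\tilde\sigma)$ on $\tilde I$, respectively, where each schedule is continuous up to time $0$ with $s(0)=1$, $\sigma(0)=0$, and differentiable at positive times with $s>0$, $\dot\sigma>0$ and $\dot s$ integrable on bounded intervals $(0,t]$. Suppose that $p_0$ is not concentrated at a single point. Then, without further assumptions, $\Phi_t$ and $\Phi_s$ are regular time changes, $F$ is a proper time change of $\Phi_t(I)$ onto $\Phi_s(\tilde I)$ with $F=\mathrm{id}$, the two SDEs written in entropic time are equivalent up to $F$, and they have the same time interval, drift and volatility. The same holds for the *rescaled entropic times* $$R_t(t)=\int_0^t\sigma(\tau)\,\dot\Phi_t(\tau)\,d\tau,\qquad R_s(s)=\int_0^s\tilde\sigma(\tau)\,\dot\Phi_s(\tau)\,d\tau$$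 in place of $\Phi_t$, $\Phi_s$ (with $R_s\circ\phi\circ R_t^{-1}$ in place of $F$): the integrals converge absolutely, $R_t$ and $R_s$ are regular time changes, $R_s\circ\phi\circ R_t^{-1}$ is a proper time change of $R_t(I)$ onto $R_s(\tilde I)$ and is the identity, the two SDEs written in rescaled entropic time are equivalent up to it, and they have the same time interval, drift and volatility. -/

import Mathlib

open MeasureTheory ProbabilityTheory Set

universe u

noncomputable section

/-- The data space `ℝ^D` with its Euclidean norm. -/
abbrev DataSpace (D : ℕ) : Type := EuclideanSpace ℝ (Fin D)

/-- The coefficients of an SDE `dX_t = f(X_t, t) dt + g(t) dW_t` in `ℝ^D`, with drift `f`, scalar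
volatility `g` and `t` ranging over the set `time`. -/
structure DiffusionSDE (D : ℕ) where
  time : Set ℝ
  drift : DataSpace D → ℝ → DataSpace D
  vol : ℝ → ℝ

/-- `I` is an interval of positive times `(0, T)` or `(0, T]` with `0 < T`, or `(0, ∞)`. The initial
time `0` itself is kept apart, since the entropic time may be infinite or singular there. -/
structure IsForwardTime (I : Set ℝ) : Prop where
  nonempty : I.Nonempty
  pos : ∀ t ∈ I, 0 < t
  down : ∀ t ∈ I, Ioc 0 t ⊆ I

/-- A proper time change on `I`: continuous and strictly increasing. -/
structure IsProperTimeChange (I : Set ℝ) (φ : ℝ → ℝ) : Prop where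
  continuousOn : ContinuousOn φ I
  strictMonoOn : StrictMonoOn φ I

/-- A proper time change with a positive derivative (one-sided at an end point that belongs to
`I`): what is needed to rewrite an SDE in the new time. -/
structure IsRegularTimeChange (I : Set ℝ) (φ : ℝ → ℝ) : Prop extends IsProperTimeChange I φ where
  differentiableOn : DifferentiableOn ℝ φ I
  deriv_pos : ∀ t ∈ I, 0 < derivWithin φ I t

namespace DiffusionSDE

variable {D : ℕ}

/-- The SDEs `S` (time `t`) and `S'` (time `s`) are equivalent up to the proper time change
`φ : t ↦ s`: `φ'(t) f'(x, φ(t)) = f(x, t)` and `√φ'(t) g'(φ(t)) = g(t)`. -/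
structure EquivVia (S S' : DiffusionSDE D) (φ : ℝ → ℝ) : Prop where
  proper : IsProperTimeChange S.time φ
  image_eq : φ '' S.time = S'.time
  differentiableOn : DifferentiableOn ℝ φ S.time
  drift_eq : ∀ x, ∀ t ∈ S.time, derivWithin φ S.time t • S'.drift x (φ t) = S.drift x t
  vol_eq : ∀ t ∈ S.time, √(derivWithin φ S.time t) * S'.vol (φ t) = S.vol t

/-- The SDE `S` rewritten in the new time `h = Φ(t)`: drift `f(x, Φ⁻¹(h)) / Φ'(Φ⁻¹(h))` and
volatility `g(Φ⁻¹(h)) / √Φ'(Φ⁻¹(h))` on the interval `Φ(time)`. -/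
def reparam (S : DiffusionSDE D) (Φ : ℝ → ℝ) : DiffusionSDE D where
  time := Φ '' S.time
  drift x h := (derivWithin Φ S.time (Function.invFunOn Φ S.time h))⁻¹ •
    S.drift x (Function.invFunOn Φ S.time h)
  vol h := S.vol (Function.invFunOn Φ S.time h) /
    √(derivWithin Φ S.time (Function.invFunOn Φ S.time h))

/-- The noise part `X_t - X_0 - ∫_0^t f(X_r, r) dr` of a process; for a solution it is
`∫_0^t g(r) dW_r`. -/
def noise (S : DiffusionSDE D) {Ω : Type u} (X : ℝ → Ω → DataSpace D) (t : ℝ) (ω : Ω) :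
    DataSpace D :=
  X t ω - X 0 ω - ∫ r in (0 : ℝ)..t, S.drift (X r ω) r

/-- `X` (on the probability space `(Ω, P)`, indexed by `{0} ∪ time`) is a weak solution of
`dX_t = f(X_t, t) dt + g(t) dW_t` with `X_0 ∼ p₀`. As `g` does not depend on the state, the
stochastic integral `N = ∫ g dW` is characterised by its increments: `N` is continuous, and
`N_t - N_r` is independent of the past of `X` up to time `r` with law
`𝒩(0, (∫_r^t g²) I)`. -/
structure IsSolution (S : DiffusionSDE D) (p₀ : Measure (DataSpace D)) {Ω : Type u}
    [MeasurableSpace Ω] (P : Measure Ω) (X : ℝ → Ω → DataSpace D) : Prop where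
  measurable : ∀ t ∈ insert 0 S.time, Measurable (X t)
  initial_law : P.map (X 0) = p₀
  continuous_paths : ∀ᵐ ω ∂P, ContinuousOn (fun t => X t ω) (insert 0 S.time)
  drift_integrable : ∀ᵐ ω ∂P, ∀ t ∈ S.time,
    IntegrableOn (fun r => S.drift (X r ω) r) (Ioc 0 t)
  vol_sq_integrable : ∀ t ∈ S.time, IntegrableOn (fun r => S.vol r ^ 2) (Ioc 0 t)
  noise_law : ∀ r ∈ insert 0 S.time, ∀ t ∈ S.time, r < t →
    HasLaw (fun ω => S.noise X t ω - S.noise X r ω)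
      ((stdGaussian (DataSpace D)).map fun z => √(∫ v in r..t, S.vol v ^ 2) • z) P
  noise_indep : ∀ r ∈ insert 0 S.time, ∀ t ∈ S.time, r < t →
    Indep (⨆ v ∈ {v | v ∈ insert 0 S.time ∧ v ≤ r},
        MeasurableSpace.comap (X v) inferInstance)
      (MeasurableSpace.comap (fun ω => S.noise X t ω - S.noise X r ω) inferInstance) P

/-- The SDE with initial law `p₀` determines the joint law of `(X_t, X_0)` for every `t`
(its forward kernel): it is the same for all solutions. -/
def DeterminesForwardLaw (S : DiffusionSDE D) (p₀ : Measure (DataSpace D)) : Prop :=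
  ∀ (Ω₁ Ω₂ : Type u) [MeasurableSpace Ω₁] [MeasurableSpace Ω₂]
    (P₁ : Measure Ω₁) (P₂ : Measure Ω₂) [IsProbabilityMeasure P₁] [IsProbabilityMeasure P₂]
    (X₁ : ℝ → Ω₁ → DataSpace D) (X₂ : ℝ → Ω₂ → DataSpace D),
    S.IsSolution p₀ P₁ X₁ → S.IsSolution p₀ P₂ X₂ → ∀ t ∈ S.time,
      P₁.map (fun ω => (X₁ t ω, X₁ 0 ω)) = P₂.map (fun ω => (X₂ t ω, X₂ 0 ω))

end DiffusionSDE

section Entropy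

variable {D : ℕ} {Ω : Type u} [MeasurableSpace Ω]

/-- The logarithm of the conditional density, with respect to the reference measure `ρ`, of `U`
given `V = y`, at the point `x`. -/
def logCondDensity (ρ : Measure (DataSpace D)) (P : Measure Ω) [IsFiniteMeasure P]
    (U V : Ω → DataSpace D) (y x : DataSpace D) : ℝ :=
  Real.log ((condDistrib U V P y).rnDeriv ρ x).toReal

/-- The conditional entropy `H[U | V] = -∫∫ log p(x | y) p(x | y) dx p(y) dy`, where `p(x | y)` is the
conditional density with respect to `ρ` (Lebesgue measure for continuous data, counting measure
on a countable set for discrete data). -/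
def condEntropy (ρ : Measure (DataSpace D)) (P : Measure Ω) [IsFiniteMeasure P]
    (U V : Ω → DataSpace D) : ℝ :=
  -∫ y, ∫ x, logCondDensity ρ P U V y x ∂(condDistrib U V P y) ∂(P.map V)

/-- `H[U | V]` makes sense and is finite: the conditional density with respect to `ρ` exists and
the double integral converges absolutely. -/
structure HasCondEntropy (ρ : Measure (DataSpace D)) (P : Measure Ω) [IsFiniteMeasure P]
    (U V : Ω → DataSpace D) : Prop where
  ac : ∀ᵐ y ∂(P.map V), condDistrib U V P y ≪ ρ
  inner : ∀ᵐ y ∂(P.map V), Integrable (logCondDensity ρ P U V y) (condDistrib U V P y)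
  outer : Integrable (fun y => ∫ x, |logCondDensity ρ P U V y x| ∂(condDistrib U V P y)) (P.map V)

/-- The entropic time `t ↦ H[x_0 | x_t]` of a process. -/
def entropicTime (ρ : Measure (DataSpace D)) (P : Measure Ω) [IsFiniteMeasure P]
    (X : ℝ → Ω → DataSpace D) (t : ℝ) : ℝ :=
  condEntropy ρ P (X 0) (X t)

end Entropy

/-- A scale function `s(t)` and a noise level `σ(t)` on the time set `time`. -/
structure NoiseSchedule where
  time : Set ℝ
  scale : ℝ → ℝ
  sigma : ℝ → ℝ

/-- `s(0) = 1`, `σ(0) = 0`, both are continuous (also at time `0`) and differentiable at positive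
times, `s > 0`, `σ' > 0`, and `s'` is integrable near `0`. -/
structure NoiseSchedule.IsAdmissible (A : NoiseSchedule) : Prop where
  forward : IsForwardTime A.time
  scale_zero : A.scale 0 = 1
  sigma_zero : A.sigma 0 = 0
  scale_continuousOn : ContinuousOn A.scale (insert 0 A.time)
  sigma_continuousOn : ContinuousOn A.sigma (insert 0 A.time)
  scale_differentiableOn : DifferentiableOn ℝ A.scale A.time
  sigma_differentiableOn : DifferentiableOn ℝ A.sigma A.time
  scale_pos : ∀ t ∈ A.time, 0 < A.scale t
  sigma_deriv_pos : ∀ t ∈ A.time, 0 < derivWithin A.sigma A.time t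
  scale_deriv_integrable : ∀ t ∈ A.time, IntegrableOn (derivWithin A.scale A.time) (Ioc 0 t)

/-- The SDE `dX_t = (s'(t) / s(t)) X_t dt + s(t) √(2 σ'(t) σ(t)) dW_t`, whose forward kernel is
`𝒩(s(t) x_0, s(t)² σ(t)² I)`. -/
def NoiseSchedule.toSDE (A : NoiseSchedule) (D : ℕ) : DiffusionSDE D where
  time := A.time
  drift x t := (derivWithin A.scale A.time t / A.scale t) • x
  vol t := A.scale t * √(2 * derivWithin A.sigma A.time t * A.sigma t)

/-- The integrand `σ(τ) Φ'(τ)` of the rescaled time, where `Φ` is the entropic time. -/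
def NoiseSchedule.rescaledRate (A : NoiseSchedule) (Φ : ℝ → ℝ) (τ : ℝ) : ℝ :=
  A.sigma τ * derivWithin Φ A.time τ

/-- The rescaled entropic time `t ↦ ∫_0^t σ(τ) Φ'(τ) dτ`, where `Φ` is the entropic time. -/
def NoiseSchedule.rescaledTime (A : NoiseSchedule) (Φ : ℝ → ℝ) (t : ℝ) : ℝ :=
  ∫ τ in (0 : ℝ)..t, A.rescaledRate Φ τ

/-- The transition map `F = Ψ ∘ φ ∘ Φ⁻¹` from the time `Φ(t)` to the time `Ψ(s)`, where
`φ : t ↦ s` and `Φ` is inverted on `I`. -/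
def transitionMap (I : Set ℝ) (φ Φ Ψ : ℝ → ℝ) : ℝ → ℝ :=
  Ψ ∘ φ ∘ Function.invFunOn Φ I

/-- `F = Ψ ∘ φ ∘ Φ⁻¹ : Φ(I) → Ψ(I')` is an onto proper time change and is the identity. -/
structure TransitionIsIdentity (I I' : Set ℝ) (φ Φ Ψ : ℝ → ℝ) : Prop where
  proper : IsProperTimeChange (Φ '' I) (transitionMap I φ Φ Ψ)
  image_eq : transitionMap I φ Φ Ψ '' (Φ '' I) = Ψ '' I'
  eqOn_id : EqOn (transitionMap I φ Φ Ψ) id (Φ '' I)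

/-- The SDEs `S` rewritten in the time `Φ` and `S'` rewritten in the time `Ψ` are equivalent up to
the time change `F = Ψ ∘ φ ∘ Φ⁻¹`, and they have the same time interval, drift and volatility. -/
structure SameInNewTimes {D : ℕ} (S S' : DiffusionSDE D) (φ Φ Ψ : ℝ → ℝ) : Prop where
  equiv : (S.reparam Φ).EquivVia (S'.reparam Ψ) (transitionMap S.time φ Φ Ψ)
  time_eq : (S.reparam Φ).time = (S'.reparam Ψ).time
  drift_eq : ∀ x, ∀ h ∈ (S.reparam Φ).time, (S.reparam Φ).drift x h = (S'.reparam Ψ).drift x h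
  vol_eq : ∀ h ∈ (S.reparam Φ).time, (S.reparam Φ).vol h = (S'.reparam Ψ).vol h

end

/-! General part. Extend `φ` by `0` at time `0`. If `Y` solves the second SDE, then `t ↦ Y (φ t)`
solves the first: path by path, the substitution rule for monotone differentiable maps carries the
drift integral and `∫ g²` over, and the noise increments are merely relabelled
(`EquivVia.isSolution`). As the first SDE determines its forward law, `(X_t, X_0)` and `(Y_{φ(t)},
Y_0)` have the same law. The conditional entropy depends on nothing else, so `Φ_s ∘ φ = Φ_t`, and
the rest is the chain rule (`EquivVia.sameInNewTimes`).

Schedules. For the linear SDE, `d(X/s) = s⁻¹ dN`, where `N` is the noise part, and `∫ g²/s² = σ²`,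
so `X_t` has the law of `sσ (z + β X_0)` with `β = 1/σ` and `z` standard Gaussian independent of
`X_0` (`jointLaw`). The forward law is therefore determined and the general part applies. It remains
to see that the entropic time is regular. By the I-MMSE relation the derivative of the entropy in
`β` is `-β V(β)`, with `V` the posterior variance (`condEntropy_sub_condEntropy`).

No moments of `p₀` are assumed. Estimates come from replicas instead: if `x, x'` are two posterior
draws given `v`, then `v - βx` and `v - βx'` are both standard Gaussian, and `β(x - x')` is their
difference. This bounds all moments of `x - x'`, makes `V` continuous and `β² V(β)` bounded; `V`
vanishes only if `p₀` is a point mass. Hence the entropic time has the positive derivative `σ'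
V(1/σ)/σ³`, and the rescaled time is the integral of the bounded function `V(1/σ)/σ²` over the noise
level. The rescaled times correspond because equivalence forces the noise levels to agree
(`sigma_comp_eq`). -/

noncomputable section

/-! ### Intervals of positive times. -/

namespace IsForwardTime

variable {I : Set ℝ}

theorem ordConnected (hI : IsForwardTime I) : I.OrdConnected :=
  ⟨fun a ha b hb _ hx => hI.down b hb ⟨(hI.pos a ha).trans_le hx.1, hx.2⟩⟩

theorem Ioo_subset_interior (hI : IsForwardTime I) {t : ℝ} (ht : t ∈ I) :
    Ioo 0 t ⊆ interior I :=
  interior_maximal (Ioo_subset_Ioc_self.trans (hI.down t ht)) isOpen_Ioo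

theorem uniqueDiffOn (hI : IsForwardTime I) : UniqueDiffOn ℝ I := by
  obtain ⟨t, ht⟩ := hI.nonempty
  have h0 := hI.pos t ht
  refine uniqueDiffOn_convex hI.ordConnected.convex ⟨t / 2, hI.Ioo_subset_interior ht ?_⟩
  constructor <;> linarith

theorem Icc_subset {I : Set ℝ} (hI : IsForwardTime I) {t : ℝ} (ht : t ∈ I) : Icc 0 t ⊆ insert 0 I := by
  intro x hx
  rcases hx.1.eq_or_lt with h | h
  · exact Or.inl h.symm
  · exact Or.inr (hI.down t ht ⟨h, hx.2⟩)

theorem nonneg (hI : IsForwardTime I) {r : ℝ} (hr : r ∈ insert 0 I) : 0 ≤ r := by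
  rcases hr with rfl | hr
  · exact le_rfl
  · exact (hI.pos r hr).le

theorem mem_of_pos {r : ℝ} (hr : r ∈ insert 0 I) (h : 0 < r) : r ∈ I := by
  rcases hr with rfl | hr
  · exact absurd h (lt_irrefl _)
  · exact hr

theorem Ioc_subset (hI : IsForwardTime I) {r t : ℝ} (hr : r ∈ insert 0 I) (ht : t ∈ I) :
    Ioc r t ⊆ I :=
  fun _ hx => hI.down t ht ⟨(hI.nonneg hr).trans_lt hx.1, hx.2⟩

theorem hasDerivAt (hI : IsForwardTime I) {f : ℝ → ℝ} (hf : DifferentiableOn ℝ f I)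
    {t v : ℝ} (ht : t ∈ I) (hv : v ∈ Ioo 0 t) : HasDerivAt f (derivWithin f I v) v := by
  have hv' := hI.Ioo_subset_interior ht hv
  exact (hf v (interior_subset hv')).hasDerivWithinAt.hasDerivAt (mem_interior_iff_mem_nhds.1 hv')

/-- Continuity makes the image an interval and strict monotonicity gives it interior points. This is
needed for `derivWithin` of the identity on the new time interval to be `1`. -/
theorem uniqueDiffWithinAt_image (hI : IsForwardTime I) {Φ : ℝ → ℝ} (hΦ : IsProperTimeChange I Φ)
    {h : ℝ} (hh : h ∈ Φ '' I) : UniqueDiffWithinAt ℝ (Φ '' I) h := by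
  have hc : (Φ '' I).OrdConnected :=
    (hI.ordConnected.isPreconnected.image Φ hΦ.continuousOn).ordConnected
  obtain ⟨t, ht⟩ := hI.nonempty
  have h0 := hI.pos t ht
  have h2 : t / 2 ∈ I := hI.down t ht ⟨by linarith, by linarith⟩
  refine uniqueDiffOn_convex hc.convex ?_ h hh
  have hlt : Φ (t / 2) < Φ t := hΦ.strictMonoOn h2 ht (by linarith)
  refine ⟨(Φ (t / 2) + Φ t) / 2, interior_maximal (Ioo_subset_Icc_self.trans
    (hc.out ⟨_, h2, rfl⟩ ⟨_, ht, rfl⟩)) isOpen_Ioo ?_⟩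
  constructor <;> linarith

end IsForwardTime

/-! ### Substitution along a change of clock. -/

/-- A strictly increasing differentiable map of one interval of positive times onto another. -/
structure IsClockChange (I I' : Set ℝ) (φ : ℝ → ℝ) : Prop where
  source : IsForwardTime I
  target : IsForwardTime I'
  strictMonoOn : StrictMonoOn φ I
  image_eq : φ '' I = I'
  differentiableOn : DifferentiableOn ℝ φ I

/-- A time change continued by `0` at the initial time. -/
def fromZero (φ : ℝ → ℝ) (t : ℝ) : ℝ := if t ≤ 0 then 0 else φ t

@[simp] theorem fromZero_zero (φ : ℝ → ℝ) : fromZero φ 0 = 0 := by simp [fromZero]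

theorem fromZero_of_pos (φ : ℝ → ℝ) {t : ℝ} (ht : 0 < t) : fromZero φ t = φ t := by
  simp [fromZero, ht.not_ge]

namespace IsClockChange

variable {I I' : Set ℝ} {φ : ℝ → ℝ}

theorem mapsTo (h : IsClockChange I I' φ) {t : ℝ} (ht : t ∈ I) : φ t ∈ I' :=
  h.image_eq ▸ mem_image_of_mem φ ht

theorem pos (h : IsClockChange I I' φ) {t : ℝ} (ht : t ∈ I) : 0 < φ t :=
  h.target.pos _ (h.mapsTo ht)

theorem exists_eq (h : IsClockChange I I' φ) {s : ℝ} (hs : s ∈ I') : ∃ t ∈ I, φ t = s := by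
  rwa [← h.image_eq] at hs

theorem fromZero_of_mem (h : IsClockChange I I' φ) {t : ℝ} (ht : t ∈ I) : fromZero φ t = φ t :=
  fromZero_of_pos φ (h.source.pos t ht)

theorem fromZero_mapsTo (h : IsClockChange I I' φ) :
    MapsTo (fromZero φ) (insert 0 I) (insert 0 I') := by
  rintro t (rfl | ht)
  · simp
  · rw [h.fromZero_of_mem ht]; exact Or.inr (h.mapsTo ht)

theorem fromZero_strictMonoOn (h : IsClockChange I I' φ) :
    StrictMonoOn (fromZero φ) (insert 0 I) := by
  rintro r hr t (rfl | ht) hrt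
  · exact absurd hrt (h.source.nonneg hr).not_gt
  · rw [h.fromZero_of_mem ht]
    rcases hr with rfl | hr
    · simpa using h.pos ht
    · rw [h.fromZero_of_mem hr]; exact h.strictMonoOn hr ht hrt

/-- Continuity at `0` is not assumed of `φ`; it follows from surjectivity. Values below any `ε` are
attained, and monotonicity keeps `φ` below them at all earlier times. -/
theorem fromZero_continuousOn (h : IsClockChange I I' φ) :
    ContinuousOn (fromZero φ) (insert 0 I) := by
  rintro t (rfl | ht)
  · rw [ContinuousWithinAt, fromZero_zero, Metric.tendsto_nhdsWithin_nhds]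
    intro ε hε
    obtain ⟨s, hs⟩ := h.target.nonempty
    have hs0 := h.target.pos s hs
    have hm : min s (ε / 2) ∈ I' :=
      h.target.down s hs ⟨lt_min hs0 (by linarith), min_le_left _ _⟩
    obtain ⟨t₀, ht₀, he⟩ := h.exists_eq hm
    refine ⟨t₀, h.source.pos t₀ ht₀, fun {x} hx hd => ?_⟩
    have hx0 := h.fromZero_mapsTo hx
    have h0 := h.target.nonneg hx0
    have hlt : fromZero φ x < fromZero φ t₀ := by
      refine h.fromZero_strictMonoOn hx (Or.inr ht₀) ?_
      rw [Real.dist_eq, sub_zero] at hd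
      exact (le_abs_self x).trans_lt hd
    rw [h.fromZero_of_mem ht₀, he] at hlt
    rw [Real.dist_eq, sub_zero, abs_of_nonneg h0]
    have := min_le_right s (ε / 2)
    linarith
  · have h0 := h.source.pos t ht
    have hc : ContinuousWithinAt φ (insert 0 I) t := by
      have := (h.differentiableOn t ht).continuousWithinAt
      refine this.mono_of_mem_nhdsWithin ?_
      filter_upwards [self_mem_nhdsWithin, mem_nhdsWithin_of_mem_nhds (Ioi_mem_nhds h0)]
        with x hx hx0
      exact IsForwardTime.mem_of_pos hx hx0
    refine hc.congr_of_eventuallyEq ?_ (h.fromZero_of_mem ht)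
    filter_upwards [mem_nhdsWithin_of_mem_nhds (Ioi_mem_nhds h0)] with x hx
    exact fromZero_of_pos φ hx

theorem image_Ioc (h : IsClockChange I I' φ) {r t : ℝ} (hr : r ∈ insert 0 I) (ht : t ∈ I) :
    φ '' Ioc r t = Ioc (fromZero φ r) (φ t) := by
  have hsub := h.source.Ioc_subset hr ht
  ext s
  constructor
  · rintro ⟨v, hv, rfl⟩
    refine ⟨?_, h.strictMonoOn.monotoneOn (hsub hv) ht hv.2⟩
    rw [← h.fromZero_of_mem (hsub hv)]
    exact h.fromZero_strictMonoOn hr (Or.inr (hsub hv)) hv.1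
  · intro hs
    have hsI : s ∈ I' := h.target.Ioc_subset (h.fromZero_mapsTo hr) (h.mapsTo ht) hs
    obtain ⟨v, hv, rfl⟩ := h.exists_eq hsI
    refine ⟨v, ⟨?_, (h.strictMonoOn.le_iff_le hv ht).1 hs.2⟩, rfl⟩
    rw [← h.fromZero_of_mem hv] at hs
    exact (h.fromZero_strictMonoOn.lt_iff_lt hr (Or.inr hv)).1 hs.1

theorem hasDerivWithinAt (h : IsClockChange I I' φ) {r t : ℝ} (hr : r ∈ insert 0 I) (ht : t ∈ I) :
    ∀ v ∈ Ioc r t, HasDerivWithinAt φ (derivWithin φ I v) (Ioc r t) v := fun v hv =>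
  (h.differentiableOn v (h.source.Ioc_subset hr ht hv)).hasDerivWithinAt.mono
    (h.source.Ioc_subset hr ht)

theorem deriv_nonneg (h : IsClockChange I I' φ) (t : ℝ) : 0 ≤ derivWithin φ I t :=
  h.strictMonoOn.monotoneOn.derivWithin_nonneg

variable {F : Type*} [NormedAddCommGroup F] [NormedSpace ℝ F]

/-- For monotone differentiable maps the substitution rule requires neither continuity of the
derivative nor any property of `G`, so it applies to an arbitrary drift along a path. -/
theorem integrableOn_Ioc_iff (h : IsClockChange I I' φ) {r t : ℝ} (hr : r ∈ insert 0 I)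
    (ht : t ∈ I) (G : ℝ → F) : IntegrableOn G (Ioc (fromZero φ r) (φ t)) ↔
      IntegrableOn (fun v => derivWithin φ I v • G (φ v)) (Ioc r t) := by
  rw [← h.image_Ioc hr ht]
  exact integrableOn_image_iff_integrableOn_deriv_smul_of_monotoneOn measurableSet_Ioc
    (h.hasDerivWithinAt hr ht) (h.strictMonoOn.monotoneOn.mono (h.source.Ioc_subset hr ht)) G

theorem integral_eq (h : IsClockChange I I' φ) {r t : ℝ} (hr : r ∈ insert 0 I) (ht : t ∈ I)
    (hrt : r ≤ t) (G : ℝ → F) :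
    ∫ s in (fromZero φ r)..(φ t), G s = ∫ v in r..t, derivWithin φ I v • G (φ v) := by
  rw [intervalIntegral.integral_of_le hrt, intervalIntegral.integral_of_le, ← h.image_Ioc hr ht]
  · exact integral_image_eq_integral_deriv_smul_of_monotoneOn measurableSet_Ioc
      (h.hasDerivWithinAt hr ht) (h.strictMonoOn.monotoneOn.mono (h.source.Ioc_subset hr ht)) G
  · rw [← h.fromZero_of_mem ht]
    exact h.fromZero_strictMonoOn.monotoneOn hr (Or.inr ht) hrt

end IsClockChange

/-! ### Time change of weak solutions. -/

namespace DiffusionSDE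

variable {D : ℕ} {S S' : DiffusionSDE D} {φ : ℝ → ℝ}

theorem EquivVia.isClockChange (hφ : S.EquivVia S' φ) (hS : IsForwardTime S.time)
    (hS' : IsForwardTime S'.time) : IsClockChange S.time S'.time φ :=
  ⟨hS, hS', hφ.proper.strictMonoOn, hφ.image_eq, hφ.differentiableOn⟩

theorem EquivVia.vol_sq (hφ : S.EquivVia S' φ) {t : ℝ} (ht : t ∈ S.time) :
    derivWithin φ S.time t * S'.vol (φ t) ^ 2 = S.vol t ^ 2 := by
  rw [← hφ.vol_eq t ht, mul_pow, Real.sq_sqrt]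
  exact hφ.proper.strictMonoOn.monotoneOn.derivWithin_nonneg

section Transfer

variable {Ω : Type u} (Y : ℝ → Ω → DataSpace D)

theorem EquivVia.integral_vol_sq (hφ : S.EquivVia S' φ) (hc : IsClockChange S.time S'.time φ)
    {r t : ℝ} (hr : r ∈ insert 0 S.time) (ht : t ∈ S.time) (hrt : r ≤ t) :
    ∫ v in r..t, S.vol v ^ 2 = ∫ s in (fromZero φ r)..(φ t), S'.vol s ^ 2 := by
  rw [hc.integral_eq hr ht hrt]
  refine intervalIntegral.integral_congr_ae (.of_forall fun v hv => ?_)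
  rw [uIoc_of_le hrt] at hv
  exact (hφ.vol_sq (hc.source.Ioc_subset hr ht hv)).symm

/-- The identity holds for every single path, so laws and independence of the noise increments
transfer without stochastic calculus. -/
theorem EquivVia.noise_eq (hφ : S.EquivVia S' φ) (hc : IsClockChange S.time S'.time φ)
    {t : ℝ} (ht : t ∈ insert 0 S.time) (ω : Ω) :
    S.noise (fun v => Y (fromZero φ v)) t ω = S'.noise Y (fromZero φ t) ω := by
  rcases ht with rfl | ht
  · simp [noise]
  · simp only [noise, fromZero_zero, hc.fromZero_of_mem ht]
    congr 1
    have h0 := hc.integral_eq (mem_insert 0 _) ht (hc.source.pos t ht).le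
      (fun s => S'.drift (Y s ω) s)
    rw [fromZero_zero] at h0
    rw [h0]
    refine intervalIntegral.integral_congr_ae (.of_forall fun v hv => ?_)
    rw [uIoc_of_le (hc.source.pos t ht).le] at hv
    have hv := hc.source.down t ht hv
    simp only [hc.fromZero_of_mem hv, hφ.drift_eq _ v hv]

/-- The core of the general part: a solution run on the other clock is again a solution, so
uniqueness of the forward law can compare it with `X`. -/
theorem EquivVia.isSolution [MeasurableSpace Ω] {p₀ : Measure (DataSpace D)} {P : Measure Ω}
    {Y : ℝ → Ω → DataSpace D} (hφ : S.EquivVia S' φ) (hc : IsClockChange S.time S'.time φ)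
    (hY : S'.IsSolution p₀ P Y) : S.IsSolution p₀ P (fun t => Y (fromZero φ t)) where
  measurable t ht := hY.measurable _ (hc.fromZero_mapsTo ht)
  initial_law := by simpa using hY.initial_law
  continuous_paths := by
    filter_upwards [hY.continuous_paths] with ω hω
    exact hω.comp hc.fromZero_continuousOn hc.fromZero_mapsTo
  drift_integrable := by
    filter_upwards [hY.drift_integrable] with ω hω t ht
    have h := hω _ (hc.mapsTo ht)
    have h' := (hc.integrableOn_Ioc_iff (mem_insert 0 _) ht (fun s => S'.drift (Y s ω) s)).1
      (by simpa using h)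
    refine h'.congr_fun (fun v hv => ?_) measurableSet_Ioc
    have hv := hc.source.down t ht hv
    simp only [hc.fromZero_of_mem hv, hφ.drift_eq _ v hv]
  vol_sq_integrable t ht := by
    have h := hY.vol_sq_integrable _ (hc.mapsTo ht)
    have h' := (hc.integrableOn_Ioc_iff (mem_insert 0 _) ht (fun s => S'.vol s ^ 2)).1
      (by simpa using h)
    refine h'.congr_fun (fun v hv => ?_) measurableSet_Ioc
    exact hφ.vol_sq (hc.source.down t ht hv)
  noise_law r hr t ht hrt := by
    have h := hY.noise_law _ (hc.fromZero_mapsTo hr) _ (hc.mapsTo ht) (by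
      rw [← hc.fromZero_of_mem ht]; exact hc.fromZero_strictMonoOn hr (Or.inr ht) hrt)
    rw [← hφ.integral_vol_sq hc hr ht hrt.le] at h
    simpa only [hφ.noise_eq Y hc hr, hφ.noise_eq Y hc (Or.inr ht), hc.fromZero_of_mem ht] using h
  noise_indep r hr t ht hrt := by
    have h := hY.noise_indep _ (hc.fromZero_mapsTo hr) _ (hc.mapsTo ht) (by
      rw [← hc.fromZero_of_mem ht]; exact hc.fromZero_strictMonoOn hr (Or.inr ht) hrt)
    simp only [hφ.noise_eq Y hc hr, hφ.noise_eq Y hc (Or.inr ht), hc.fromZero_of_mem ht]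
    -- The past of the time-changed process up to `r` lies in the past of `Y` up to `φ(r)`, and
    -- independence passes to smaller σ-algebras.
    refine indep_of_indep_of_le_left h (iSup₂_le fun v hv => ?_)
    refine le_iSup₂_of_le (fromZero φ v) ⟨hc.fromZero_mapsTo hv.1, ?_⟩ le_rfl
    exact hc.fromZero_strictMonoOn.monotoneOn hv.1 hr hv.2

end Transfer

/-- A solution of the time changed SDE has the same joint laws at corresponding times. -/
theorem EquivVia.jointLaw_eq (hφ : S.EquivVia S' φ) (hc : IsClockChange S.time S'.time φ)
    {p₀ : Measure (DataSpace D)} (hd : DeterminesForwardLaw.{u} S p₀)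
    {Ω Ω' : Type u} [MeasurableSpace Ω] [MeasurableSpace Ω'] {P : Measure Ω}
    [IsProbabilityMeasure P] {P' : Measure Ω'} [IsProbabilityMeasure P']
    {X : ℝ → Ω → DataSpace D} {Y : ℝ → Ω' → DataSpace D}
    (hX : S.IsSolution p₀ P X) (hY : S'.IsSolution p₀ P' Y) {t : ℝ} (ht : t ∈ S.time) :
    P.map (fun ω => (X t ω, X 0 ω)) = P'.map (fun ω => (Y (φ t) ω, Y 0 ω)) := by
  have h := hd Ω Ω' P P' X _ hX (hφ.isSolution hc hY) t ht
  simpa only [fromZero_zero, hc.fromZero_of_mem ht] using h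

end DiffusionSDE

/-! ### Conditional entropy as a function of the joint law. -/

section Entropy

variable {D : ℕ} {Ω Ω' : Type u} [MeasurableSpace Ω] [MeasurableSpace Ω']
  {P : Measure Ω} {P' : Measure Ω'}
  {U V : Ω → DataSpace D} {U' V' : Ω' → DataSpace D}

theorem map_eq_of_jointLaw (hU : Measurable U) (hU' : Measurable U')
    (h : P.map (fun ω => (V ω, U ω)) = P'.map (fun ω => (V' ω, U' ω))) :
    P.map V = P'.map V' := by
  rw [← Measure.fst_map_prodMk (X := V) hU, h, Measure.fst_map_prodMk hU']

variable [IsFiniteMeasure P] [IsFiniteMeasure P']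

/-- `condDistrib` is constructed from the joint law alone, so the two kernels agree everywhere and
not just almost everywhere. -/
theorem condDistrib_eq_of_jointLaw (h : P.map (fun ω => (V ω, U ω)) =
    P'.map (fun ω => (V' ω, U' ω))) : condDistrib U V P = condDistrib U' V' P' := by
  simp only [condDistrib_def, h]

theorem logCondDensity_eq_of_jointLaw (ρ : Measure (DataSpace D))
    (h : P.map (fun ω => (V ω, U ω)) = P'.map (fun ω => (V' ω, U' ω))) (y x : DataSpace D) :
    logCondDensity ρ P U V y x = logCondDensity ρ P' U' V' y x := by
  simp only [logCondDensity, condDistrib_eq_of_jointLaw h]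

theorem condEntropy_eq_of_jointLaw (ρ : Measure (DataSpace D)) (hU : Measurable U)
    (hU' : Measurable U')
    (h : P.map (fun ω => (V ω, U ω)) = P'.map (fun ω => (V' ω, U' ω))) :
    condEntropy ρ P U V = condEntropy ρ P' U' V' := by
  simp only [condEntropy, logCondDensity, condDistrib_eq_of_jointLaw h, map_eq_of_jointLaw hU hU' h]

theorem HasCondEntropy.of_jointLaw {ρ : Measure (DataSpace D)} (hU : Measurable U)
    (hU' : Measurable U') (h : P.map (fun ω => (V ω, U ω)) = P'.map (fun ω => (V' ω, U' ω)))
    (hH : HasCondEntropy ρ P U V) : HasCondEntropy ρ P' U' V' := by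
  obtain ⟨h₁, h₂, h₃⟩ := hH
  have hκ := condDistrib_eq_of_jointLaw h
  have hm := map_eq_of_jointLaw hU hU' h
  constructor
  · rwa [← hκ, ← hm]
  · simpa only [funext fun y => funext (logCondDensity_eq_of_jointLaw ρ h y), hκ, hm] using h₂
  · simpa only [logCondDensity, hκ, hm] using h₃

end Entropy

/-! ### The transition map between new times. -/

section Transition

variable {I I' : Set ℝ} {φ Φ Ψ : ℝ → ℝ}

theorem IsProperTimeChange.invFunOn_apply (hΦ : IsProperTimeChange I Φ) {t : ℝ} (ht : t ∈ I) :
    Function.invFunOn Φ I (Φ t) = t :=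
  hΦ.strictMonoOn.injOn.leftInvOn_invFunOn ht

/-- If `Ψ ∘ φ = Φ`, the transition map is the identity. -/
theorem IsProperTimeChange.transitionIsIdentity (hΦ : IsProperTimeChange I Φ)
    (himage : φ '' I = I') (heq : ∀ t ∈ I, Ψ (φ t) = Φ t) :
    TransitionIsIdentity I I' φ Φ Ψ := by
  have hid : EqOn (transitionMap I φ Φ Ψ) id (Φ '' I) := by
    rintro _ ⟨t, ht, rfl⟩
    simp [transitionMap, hΦ.invFunOn_apply ht, heq t ht]
  refine ⟨⟨continuousOn_id.congr hid, (strictMono_id.strictMonoOn _).congr hid.symm⟩, ?_, hid⟩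
  rw [hid.image_eq, image_id, ← himage, image_image]
  exact (image_congr heq).symm

theorem IsClockChange.isProperTimeChange (hc : IsClockChange I I' φ)
    (hΦ : IsProperTimeChange I Φ) (heq : ∀ t ∈ I, Ψ (φ t) = Φ t) : IsProperTimeChange I' Ψ := by
  have hmono : StrictMonoOn Ψ I' := by
    intro a ha' b hb' hab
    obtain ⟨a, ha, rfl⟩ := hc.exists_eq ha'
    obtain ⟨b, hb, rfl⟩ := hc.exists_eq hb'
    rw [heq a ha, heq b hb]
    exact hΦ.strictMonoOn ha hb ((hc.strictMonoOn.lt_iff_lt ha hb).1 hab)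
  refine ⟨?_, hmono⟩
  have himage : Ψ '' I' = Φ '' I := by
    rw [← hc.image_eq, image_image]; exact image_congr heq
  have hconn : (Ψ '' I').OrdConnected := by
    rw [himage]
    exact (hc.source.ordConnected.isPreconnected.image Φ hΦ.continuousOn).ordConnected
  have := hc.target.ordConnected
  rw [continuousOn_iff_continuous_domRestrict]
  -- `Ψ` is an order isomorphism between two intervals, hence continuous for their order topologies;
  -- this spares any continuity of the inverse of `φ`.
  let e := (hmono.orderIso Ψ I')
  have he : Continuous e := e.continuous
  exact continuous_subtype_val.comp he

/-- If `Ψ ∘ φ = Φ` for regular time changes, the rewritten SDEs coincide. -/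
theorem DiffusionSDE.EquivVia.sameInNewTimes {D : ℕ} {S S' : DiffusionSDE D}
    (hφ : S.EquivVia S' φ) (hc : IsClockChange S.time S'.time φ)
    (hΦ : IsRegularTimeChange S.time Φ) (hΨ : IsRegularTimeChange S'.time Ψ)
    (heq : ∀ t ∈ S.time, Ψ (φ t) = Φ t) : SameInNewTimes S S' φ Φ Ψ := by
  have htr := hΦ.toIsProperTimeChange.transitionIsIdentity hc.image_eq heq
  have htime : Φ '' S.time = Ψ '' S'.time := by
    rw [← hc.image_eq, image_image]; exact (image_congr heq).symm
  have hderiv : ∀ t ∈ S.time, derivWithin Ψ S'.time (φ t) * derivWithin φ S.time t =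
      derivWithin Φ S.time t := by
    intro t ht
    have h := (hΨ.differentiableOn (φ t) (hc.mapsTo ht)).hasDerivWithinAt.comp t
      (hc.differentiableOn t ht).hasDerivWithinAt (fun _ => hc.mapsTo)
    rw [← h.derivWithin (hc.source.uniqueDiffOn t ht)]
    exact derivWithin_congr heq (heq t ht)
  -- Positivity of the derivative of `φ` is not part of equivalence. It is forced here by the chain
  -- rule, since the product with the derivative of `Ψ` is positive.
  have hpos : ∀ t ∈ S.time, 0 < derivWithin φ S.time t := fun t ht =>
    (hc.deriv_nonneg t).lt_of_ne fun h0 => by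
      have := hderiv t ht
      rw [← h0, mul_zero] at this
      exact (hΦ.deriv_pos t ht).ne this
  have hinv : ∀ t ∈ S.time, Function.invFunOn Ψ S'.time (Φ t) = φ t := fun t ht => by
    rw [← heq t ht]; exact hΨ.invFunOn_apply (hc.mapsTo ht)
  have hdrift : ∀ x, ∀ h ∈ (S.reparam Φ).time,
      (S.reparam Φ).drift x h = (S'.reparam Ψ).drift x h := by
    rintro x _ ⟨t, ht, rfl⟩
    simp only [DiffusionSDE.reparam, hΦ.invFunOn_apply ht, hinv t ht]
    rw [← hφ.drift_eq x t ht, ← hderiv t ht, smul_smul, mul_inv, mul_assoc,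
      inv_mul_cancel₀ (hpos t ht).ne', mul_one]
  have hvol : ∀ h ∈ (S.reparam Φ).time, (S.reparam Φ).vol h = (S'.reparam Ψ).vol h := by
    rintro _ ⟨t, ht, rfl⟩
    simp only [DiffusionSDE.reparam, hΦ.invFunOn_apply ht, hinv t ht]
    rw [← hφ.vol_eq t ht, ← hderiv t ht, Real.sqrt_mul' _ (hpos t ht).le, mul_comm,
      mul_div_mul_right _ _ (Real.sqrt_pos.2 (hpos t ht)).ne']
  -- The transition map is the identity on an interval, so its derivative is `1` and equivalence
  -- reduces to equality of coefficients.
  have hone : ∀ h ∈ (S.reparam Φ).time,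
      derivWithin (transitionMap S.time φ Φ Ψ) (S.reparam Φ).time h = 1 := by
    intro h hh
    change derivWithin _ (Φ '' S.time) h = 1
    rw [derivWithin_congr htr.eqOn_id (htr.eqOn_id hh)]
    exact derivWithin_id _ _ (hc.source.uniqueDiffWithinAt_image hΦ.toIsProperTimeChange hh)
  refine ⟨⟨htr.proper, htr.image_eq, differentiableOn_id.congr htr.eqOn_id, ?_, ?_⟩, htime,
    hdrift, hvol⟩
  · intro x h hh
    rw [hone h hh, one_smul, htr.eqOn_id hh]
    exact (hdrift x h hh).symm
  · intro h hh
    rw [hone h hh, Real.sqrt_one, one_mul, htr.eqOn_id hh]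
    exact (hvol h hh).symm

end Transition

end

/-! ### The Gaussian channel: Bayes' rule and replicas. -/

noncomputable section

section GaussianChannel

variable {E : Type*} [NormedAddCommGroup E]

/-- The unnormalised standard Gaussian density. -/
def gaussWeight (z : E) : ℝ := Real.exp (-‖z‖ ^ 2 / 2)

theorem gaussWeight_pos (z : E) : 0 < gaussWeight z := Real.exp_pos _

theorem gaussWeight_le_one (z : E) : gaussWeight z ≤ 1 :=
  Real.exp_le_one_iff.2 (by have := sq_nonneg ‖z‖; linarith)

@[fun_prop]
theorem continuous_gaussWeight : Continuous (gaussWeight : E → ℝ) := by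
  unfold gaussWeight; fun_prop

@[fun_prop]
theorem measurable_gaussWeight [MeasurableSpace E] [BorelSpace E] :
    Measurable (gaussWeight : E → ℝ) :=
  continuous_gaussWeight.measurable

variable [InnerProductSpace ℝ E] [FiniteDimensional ℝ E] [MeasurableSpace E] [BorelSpace E]

theorem integrable_gaussWeight : Integrable (gaussWeight : E → ℝ) volume := by
  have h := (GaussianFourier.integrable_cexp_neg_mul_sq_norm_add (V := E) (b := 1 / 2)
    (by norm_num) 0 0).norm
  refine h.congr (.of_forall fun z => ?_)
  simp only [Complex.norm_exp, gaussWeight]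
  congr 1
  have : (-(1 / 2 : ℂ) * (‖z‖ : ℂ) ^ 2 + 0 * ((inner ℝ (0 : E) z : ℝ) : ℂ)) =
      ((-‖z‖ ^ 2 / 2 : ℝ) : ℂ) := by push_cast; ring
  rw [this, Complex.ofReal_re]

/-- Both measures have the same characteristic function. The value of `c` is irrelevant, because it
cancels in the posterior. -/
theorem exists_stdGaussian_eq_withDensity : ∃ c : ℝ, 0 < c ∧ stdGaussian E =
    volume.withDensity fun z => ENNReal.ofReal (c * gaussWeight z) := by
  set K : ℝ := ∫ z : E, gaussWeight z with hK
  have hKpos : 0 < K := integral_exp_pos integrable_gaussWeight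
  refine ⟨K⁻¹, inv_pos.2 hKpos, ?_⟩
  have hnn : ∀ z : E, 0 ≤ K⁻¹ * gaussWeight z := fun z =>
    mul_nonneg (inv_nonneg.2 hKpos.le) (gaussWeight_pos z).le
  have hfin : IsFiniteMeasure (volume.withDensity fun z : E =>
      ENNReal.ofReal (K⁻¹ * gaussWeight z)) :=
    isFiniteMeasure_withDensity_ofReal (integrable_gaussWeight.const_mul _).2
  refine Measure.ext_of_charFun (funext fun t => ?_)
  have hF : ∀ t : E, ∫ v : E, ((gaussWeight v : ℝ) : ℂ) * Complex.exp (inner ℝ v t * Complex.I) =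
      (Real.pi / (1 / 2 : ℂ)) ^ (Module.finrank ℝ E / 2 : ℂ) * Complex.exp (-‖t‖ ^ 2 / 2) := by
    intro t
    have h := GaussianFourier.integral_cexp_neg_mul_sq_norm_add (V := E) (b := 1 / 2)
      (by norm_num) Complex.I t
    have e : Complex.exp (-‖t‖ ^ 2 / 2) =
        Complex.exp (Complex.I ^ 2 * ‖t‖ ^ 2 / (4 * (1 / 2))) := by
      congr 1; rw [Complex.I_sq]; ring
    rw [e, ← h]
    refine integral_congr_ae (.of_forall fun v => ?_)
    simp only [gaussWeight]
    rw [Complex.ofReal_exp, ← Complex.exp_add, real_inner_comm]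
    congr 1
    push_cast
    ring
  -- The normalising constant is the Fourier formula at frequency `0`.
  have hK' : (Real.pi / (1 / 2 : ℂ)) ^ (Module.finrank ℝ E / 2 : ℂ) = (K : ℂ) := by
    have h := hF 0
    simp only [inner_zero_right, Complex.ofReal_zero, zero_mul, Complex.exp_zero, mul_one,
      norm_zero] at h
    rw [integral_complex_ofReal, ← hK] at h
    rw [h]; simp
  rw [charFun_stdGaussian, charFun_apply, integral_withDensity_eq_integral_toReal_smul (by fun_prop)
    (.of_forall fun _ => ENNReal.ofReal_lt_top)]
  have : ∀ x : E, (ENNReal.ofReal (K⁻¹ * gaussWeight x)).toReal •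
      Complex.exp (inner ℝ x t * Complex.I) =
      (K⁻¹ : ℂ) * (((gaussWeight x : ℝ) : ℂ) * Complex.exp (inner ℝ x t * Complex.I)) := by
    intro x
    rw [ENNReal.toReal_ofReal (hnn x), Complex.real_smul]
    push_cast; ring
  simp_rw [this]
  rw [integral_const_mul, hF, hK', ← mul_assoc, inv_mul_cancel₀ (by exact_mod_cast hKpos.ne'),
    one_mul]

variable (μ : Measure E) [IsProbabilityMeasure μ] (β : ℝ)

/-- The likelihood normalisation `∫ exp(-‖v - β x‖² / 2) μ(dx)` of an observation `v`. -/
def evidence (v : E) : ℝ := ∫ x, gaussWeight (v - β • x) ∂μ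

theorem integrable_gaussWeight_comp (v : E) : Integrable (fun x => gaussWeight (v - β • x)) μ :=
  Integrable.of_bound (by fun_prop) 1 (.of_forall fun x => by
    rw [Real.norm_of_nonneg (gaussWeight_pos _).le]; exact gaussWeight_le_one _)

theorem evidence_pos (v : E) : 0 < evidence μ β v :=
  integral_exp_pos (integrable_gaussWeight_comp μ β v)

theorem measurable_evidence_uncurry : Measurable fun p : ℝ × E => evidence μ p.1 p.2 := by
  unfold evidence
  have h : Measurable fun q : (ℝ × E) × E => gaussWeight (q.1.2 - q.1.1 • q.2) := by fun_prop
  exact (h.stronglyMeasurable.integral_prod_right (ν := μ)).measurable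

theorem measurable_evidence : Measurable (evidence μ β) := by
  have h : Measurable fun q : E × E => gaussWeight (q.1 - β • q.2) := by fun_prop
  exact (h.stronglyMeasurable.integral_prod_right (ν := μ)).measurable

/-- The posterior law of `x ∼ μ` given `z + β x = v` with an independent Gaussian `z`. -/
def gaussPosterior : Kernel E E :=
  Kernel.withDensity (Kernel.const E μ) fun v x =>
    ENNReal.ofReal (gaussWeight (v - β • x) / evidence μ β v)

theorem measurable_posteriorDensity : Measurable (Function.uncurry fun v x : E =>
    ENNReal.ofReal (gaussWeight (v - β • x) / evidence μ β v)) := by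
  have := measurable_evidence μ β
  unfold Function.uncurry
  fun_prop

theorem posterior_apply (v : E) : gaussPosterior μ β v =
    μ.withDensity fun x => ENNReal.ofReal (gaussWeight (v - β • x) / evidence μ β v) := by
  rw [gaussPosterior, Kernel.withDensity_apply _ (measurable_posteriorDensity μ β), Kernel.const_apply]

/-- As an exponential tilting of `μ`, the posterior has a positive density; hence it has the same
null sets as `μ`, and its density with respect to any reference measure is explicit. -/
theorem posterior_apply_tilted (v : E) :
    gaussPosterior μ β v = μ.tilted fun x => -‖v - β • x‖ ^ 2 / 2 :=
  posterior_apply μ β v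

instance : IsMarkovKernel (gaussPosterior μ β) :=
  ⟨fun v => by
    rw [posterior_apply_tilted]
    exact isProbabilityMeasure_tilted (integrable_gaussWeight_comp μ β v)⟩

theorem absolutelyContinuous_posterior (v : E) : μ ≪ gaussPosterior μ β v := by
  rw [posterior_apply_tilted]
  exact absolutelyContinuous_tilted (integrable_gaussWeight_comp μ β v)

theorem posterior_absolutelyContinuous (v : E) : gaussPosterior μ β v ≪ μ := by
  rw [posterior_apply_tilted]
  exact tilted_absolutelyContinuous _ _

/-- The joint law of `(z, x)`, Gaussian noise and data. -/
abbrev noiseData : Measure (E × E) := (stdGaussian E).prod μ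

/-- The law of the observation `z + β x`. -/
def obsLaw : Measure E := (noiseData μ).map fun p => p.1 + β • p.2

instance : IsProbabilityMeasure (obsLaw μ β) :=
  Measure.isProbabilityMeasure_map (by fun_prop)

/-- Substituting `z = v - βx` for fixed `x` is a translation of Lebesgue measure, which gives the
joint density of observation and datum with respect to `dv μ(dx)`. -/
theorem lintegral_noiseData {c : ℝ} (hγ : stdGaussian E =
    volume.withDensity fun z => ENNReal.ofReal (c * gaussWeight z)) {F : E × E → ENNReal}
    (hF : Measurable F) : ∫⁻ p, F (p.1 + β • p.2, p.2) ∂(noiseData μ) =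
      ∫⁻ v, ∫⁻ x, ENNReal.ofReal (c * gaussWeight (v - β • x)) * F (v, x) ∂μ := by
  rw [noiseData, lintegral_prod_symm _ (by fun_prop)]
  conv_rhs => rw [lintegral_lintegral_swap (by fun_prop)]
  refine lintegral_congr fun x => ?_
  rw [hγ, lintegral_withDensity_eq_lintegral_mul _ (by fun_prop) (by fun_prop)]
  rw [← lintegral_add_right_eq_self (fun v => ENNReal.ofReal (c * gaussWeight (v - β • x)) *
    F (v, x)) (β • x)]
  simp

/-- Bayes' rule: the joint law of `(z + β x, x)` disintegrates along the posterior. -/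
theorem map_noiseData_eq_compProd :
    (noiseData μ).map (fun p => (p.1 + β • p.2, p.2)) = obsLaw μ β ⊗ₘ gaussPosterior μ β := by
  obtain ⟨c, hc, hγ⟩ := exists_stdGaussian_eq_withDensity (E := E)
  refine Measure.ext_of_lintegral _ fun F hF => ?_
  have hpost : Measurable fun v => ∫⁻ x, F (v, x) ∂(gaussPosterior μ β v) :=
    Measurable.lintegral_kernel_prod_right' hF
  rw [lintegral_map hF (by fun_prop), Measure.lintegral_compProd hF, obsLaw,
    lintegral_map hpost (by fun_prop), lintegral_noiseData μ β hγ hF,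
    lintegral_noiseData μ β hγ (F := fun q => ∫⁻ x, F (q.1, x) ∂(gaussPosterior μ β q.1))
      (hpost.comp measurable_fst)]
  refine lintegral_congr fun v => ?_
  have hZ := evidence_pos μ β v
  dsimp only
  rw [lintegral_mul_const _ (by fun_prop), posterior_apply,
    lintegral_withDensity_eq_lintegral_mul _ (by fun_prop) (by fun_prop)]
  have h1 : ∫⁻ x, ENNReal.ofReal (c * gaussWeight (v - β • x)) ∂μ =
      ENNReal.ofReal (c * evidence μ β v) := by
    rw [evidence, ← integral_const_mul, ofReal_integral_eq_lintegral_ofReal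
      ((integrable_gaussWeight_comp μ β v).const_mul c)]
    exact .of_forall fun x => (mul_pos hc (gaussWeight_pos _)).le
  rw [h1, ← lintegral_const_mul _ (by fun_prop)]
  refine lintegral_congr fun x => ?_
  simp only [Pi.mul_apply]
  rw [← mul_assoc, ← ENNReal.ofReal_mul (mul_pos hc hZ).le]
  congr 2
  field_simp

/-- The law of an observation and two independent draws from its posterior. -/
def replicaLaw : Measure (E × E × E) := obsLaw μ β ⊗ₘ (gaussPosterior μ β ×ₖ gaussPosterior μ β)

instance : IsProbabilityMeasure (replicaLaw μ β) := by unfold replicaLaw; infer_instance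

theorem lintegral_replicaLaw {F : E × E × E → ENNReal} (hF : Measurable F) :
    ∫⁻ q, F q ∂(replicaLaw μ β) = ∫⁻ v, ∫⁻ x, ∫⁻ x', F (v, x, x') ∂(gaussPosterior μ β v)
      ∂(gaussPosterior μ β v) ∂(obsLaw μ β) := by
  rw [replicaLaw, Measure.lintegral_compProd hF]
  refine lintegral_congr fun v => ?_
  rw [Kernel.prod_apply, lintegral_prod _ (by fun_prop)]

/-- By Bayes' rule the true datum is itself a posterior draw, so datum and one further draw form a
pair of replicas. -/
theorem lintegral_noiseData_posterior {F : E × E × E → ENNReal} (hF : Measurable F) :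
    ∫⁻ p, ∫⁻ x', F (p.1 + β • p.2, p.2, x') ∂(gaussPosterior μ β (p.1 + β • p.2)) ∂(noiseData μ) =
      ∫⁻ q, F q ∂(replicaLaw μ β) := by
  have hm : Measurable fun q : E × E => ∫⁻ x', F (q.1, q.2, x') ∂(gaussPosterior μ β q.1) := by
    have : Measurable fun r : (E × E) × E => F (r.1.1, r.1.2, r.2) := by fun_prop
    exact this.lintegral_kernel_prod_right' (κ := (gaussPosterior μ β).comap Prod.fst measurable_fst)
  rw [lintegral_replicaLaw μ β hF, ← Measure.lintegral_compProd hm, ← map_noiseData_eq_compProd,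
    lintegral_map hm (by fun_prop)]

theorem replicaLaw_map_swap :
    (replicaLaw μ β).map (fun q => (q.1, q.2.2, q.2.1)) = replicaLaw μ β := by
  refine Measure.ext_of_lintegral _ fun F hF => ?_
  rw [lintegral_map hF (by fun_prop), lintegral_replicaLaw μ β hF,
    lintegral_replicaLaw μ β (F := fun q => F (q.1, q.2.2, q.2.1)) (by fun_prop)]
  refine lintegral_congr fun v => ?_
  exact lintegral_lintegral_swap (by fun_prop)

/-- Taking the true datum as the first replica, `v - βx` is the noise itself. With exchangeability
the same holds for the second replica; all moment bounds rest on this. -/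
theorem replicaLaw_map_noise :
    (replicaLaw μ β).map (fun q => q.1 - β • q.2.1) = stdGaussian E := by
  refine Measure.ext_of_lintegral _ fun F hF => ?_
  rw [lintegral_map hF (by fun_prop), ← lintegral_noiseData_posterior μ β
    (F := fun q => F (q.1 - β • q.2.1)) (by fun_prop)]
  simp only [add_sub_cancel_right, lintegral_const, measure_univ, mul_one]
  rw [noiseData, lintegral_prod _ (by fun_prop)]
  simp

end GaussianChannel

end

/-! ### The slope of the mean log-likelihood and the posterior variance. -/

noncomputable section

section GaussianChannel

variable {E : Type*} [NormedAddCommGroup E]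

theorem gaussWeight_mul_le_one (u : E) : gaussWeight u * (1 + ‖u‖ ^ 2 / 2) ≤ 1 := by
  have h := Real.add_one_le_exp (‖u‖ ^ 2 / 2)
  calc gaussWeight u * (1 + ‖u‖ ^ 2 / 2) ≤ gaussWeight u * Real.exp (‖u‖ ^ 2 / 2) :=
        mul_le_mul_of_nonneg_left (by linarith) (gaussWeight_pos u).le
    _ = 1 := by rw [gaussWeight, ← Real.exp_add]; simp [neg_div]

theorem norm_mul_gaussWeight_le (u : E) : ‖u‖ * gaussWeight u ≤ 1 := by
  refine le_trans ?_ (gaussWeight_mul_le_one u)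
  rw [mul_comm]
  exact mul_le_mul_of_nonneg_left (by nlinarith [sq_nonneg (‖u‖ - 1)]) (gaussWeight_pos u).le

theorem norm_sq_mul_gaussWeight_le (u : E) : ‖u‖ ^ 2 * gaussWeight u ≤ 2 := by
  have := gaussWeight_mul_le_one u
  have := gaussWeight_pos u
  nlinarith

variable [InnerProductSpace ℝ E]

theorem hasDerivAt_gaussWeight (z y : E) (b : ℝ) :
    HasDerivAt (fun b : ℝ => gaussWeight (z + b • y))
      (-(inner ℝ (z + b • y) y) * gaussWeight (z + b • y)) b := by
  have h1 : HasDerivAt (fun b : ℝ => z + b • y) y b := by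
    simpa using ((hasDerivAt_id b).smul_const y).const_add z
  have h2 := ((h1.norm_sq.neg.div_const 2).exp)
  refine h2.congr_deriv ?_
  change Real.exp (-‖z + b • y‖ ^ 2 / 2) * _ = _ * Real.exp (-‖z + b • y‖ ^ 2 / 2)
  ring

theorem norm_le_of_add_smul {z y : E} {b : ℝ} (hb : 0 < b) :
    ‖y‖ ≤ (‖z + b • y‖ + ‖z‖) / b := by
  rw [le_div_iff₀ hb]
  calc ‖y‖ * b = ‖(z + b • y) - z‖ := by
        rw [add_sub_cancel_left, norm_smul, Real.norm_of_nonneg hb.le, mul_comm]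
    _ ≤ _ := norm_sub_le _ _

/-- Dominates the `b`-derivative of `gaussWeight` uniformly in the unbounded `y`: away from `b = 0`,
`y` is controlled by `z + b y` and `z`, and the Gaussian weight absorbs powers of `z + b y`. -/
theorem abs_inner_mul_gaussWeight_le {z y : E} {b β : ℝ} (hβ : 0 < β) (hb : β ≤ b) :
    |inner ℝ (z + b • y) y * gaussWeight (z + b • y)| ≤ (2 + ‖z‖) / β := by
  set u := z + b • y with hu
  have hb0 := hβ.trans_le hb
  have hy : ‖y‖ ≤ (‖u‖ + ‖z‖) / β := (norm_le_of_add_smul hb0).trans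
    (div_le_div_of_nonneg_left (by positivity) hβ hb)
  have hg := (gaussWeight_pos u).le
  rw [abs_mul, abs_of_nonneg hg]
  calc |inner ℝ u y| * gaussWeight u ≤ (‖u‖ * ((‖u‖ + ‖z‖) / β)) * gaussWeight u := by
        refine mul_le_mul_of_nonneg_right ((abs_real_inner_le_norm u y).trans ?_) hg
        exact mul_le_mul_of_nonneg_left hy (norm_nonneg _)
    _ = (‖u‖ ^ 2 * gaussWeight u + ‖u‖ * gaussWeight u * ‖z‖) / β := by ring
    _ ≤ _ := by
        refine div_le_div_of_nonneg_right (add_le_add (norm_sq_mul_gaussWeight_le u) ?_) hβ.le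
        exact mul_le_of_le_one_left (norm_nonneg _) (norm_mul_gaussWeight_le u)

variable [FiniteDimensional ℝ E] [MeasurableSpace E] [BorelSpace E]
  (μ : Measure E) [IsProbabilityMeasure μ]

theorem integral_posterior (β : ℝ) (v : E) (g : E → ℝ) :
    ∫ x, g x ∂(gaussPosterior μ β v) =
      (∫ x, gaussWeight (v - β • x) * g x ∂μ) / evidence μ β v := by
  rw [posterior_apply_tilted, integral_tilted, ← integral_div]
  refine integral_congr_ae (.of_forall fun x => ?_)
  simp only [smul_eq_mul, gaussWeight, evidence]
  ring

/-- The log-likelihood `log ∫ exp(-‖z + β (x - x')‖² / 2) μ(dx')`. -/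
def logEvidence (β : ℝ) (p : E × E) : ℝ := Real.log (evidence μ β (p.1 + β • p.2))

/-- The derivative of the log-likelihood in `β`. -/
def logEvidenceSlope (β : ℝ) (p : E × E) : ℝ :=
  -∫ x', inner ℝ (p.1 + β • p.2 - β • x') (p.2 - x') ∂(gaussPosterior μ β (p.1 + β • p.2))

theorem hasDerivAt_logEvidence {β : ℝ} (hβ : 0 < β) (p : E × E) :
    HasDerivAt (fun b => logEvidence μ b p) (logEvidenceSlope μ β p) β := by
  obtain ⟨z, x⟩ := p
  -- The observation `z + b x` moves with `b` as well, so the derivative involves `x - x'` instead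
  -- of `x'` alone.
  have key : ∀ (b : ℝ) (x' : E), z + b • x - b • x' = z + b • (x - x') := fun b x' => by
    rw [smul_sub, add_sub_assoc]
  -- The neighbourhood `b > β/2` stays away from `0`, where the dominating constant would blow up.
  have h := (hasDerivAt_integral_of_dominated_loc_of_deriv_le (μ := μ)
    (F := fun b x' => gaussWeight (z + b • (x - x')))
    (F' := fun b x' => -(inner ℝ (z + b • (x - x')) (x - x')) * gaussWeight (z + b • (x - x')))
    (bound := fun _ => (2 + ‖z‖) / (β / 2)) (x₀ := β) (s := Ioi (β / 2))
    (Ioi_mem_nhds (by linarith)) (.of_forall fun b => by fun_prop) ?_ ?_ ?_ (integrable_const _)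
    (.of_forall fun x' b _ => hasDerivAt_gaussWeight z (x - x') b)).2
  · have hev : (fun b => evidence μ b (z + b • x)) =
        fun b => ∫ x', gaussWeight (z + b • (x - x')) ∂μ := by
      funext b; simp only [evidence, key]
    have h' : HasDerivAt (fun b => evidence μ b (z + b • x)) _ β := hev ▸ h
    have h2 := h'.log (evidence_pos μ β _).ne'
    refine h2.congr_deriv ?_
    simp only [logEvidenceSlope, integral_posterior, key]
    rw [← neg_div, ← integral_neg]
    congr 1
    refine integral_congr_ae (.of_forall fun x' => ?_)
    simp only; ring
  · simpa only [key] using integrable_gaussWeight_comp μ β (z + β • x)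
  · fun_prop
  · refine .of_forall fun x' b hb => ?_
    rw [neg_mul, norm_neg]
    exact abs_inner_mul_gaussWeight_le (half_pos hβ) (mem_Ioi.1 hb).le

theorem measurable_logEvidenceSlope :
    Measurable fun q : ℝ × (E × E) => logEvidenceSlope μ q.1 q.2 := by
  have h1 : Measurable fun r : (ℝ × (E × E)) × E =>
      gaussWeight (r.1.2.1 + r.1.1 • r.1.2.2 - r.1.1 • r.2) *
        inner ℝ (r.1.2.1 + r.1.1 • r.1.2.2 - r.1.1 • r.2) (r.1.2.2 - r.2) := by fun_prop
  have h2 := (h1.stronglyMeasurable.integral_prod_right' (ν := μ)).measurable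
  have h3 : Measurable fun q : ℝ × (E × E) => (q.1, q.2.1 + q.1 • q.2.2) := by fun_prop
  have h4 := (measurable_evidence_uncurry μ).comp h3
  simp only [logEvidenceSlope, integral_posterior]
  exact (h2.div h4).neg

theorem integrable_norm_pow_stdGaussian (k : ℕ) :
    Integrable (fun z : E => ‖z‖ ^ k) (stdGaussian E) := by
  have := (IsGaussian.memLp_id (stdGaussian E) (k : ENNReal) (by simp)).integrable_norm_pow'
  simpa using this

variable (β : ℝ)

theorem integrable_noise_pow (k : ℕ) :
    Integrable (fun q : E × E × E => ‖q.1 - β • q.2.1‖ ^ k) (replicaLaw μ β) := by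
  have h := integrable_norm_pow_stdGaussian (E := E) k
  rw [← replicaLaw_map_noise μ β] at h
  exact h.comp_measurable (f := fun q : E × E × E => q.1 - β • q.2.1) (by fun_prop)

theorem integral_noise_pow (k : ℕ) :
    ∫ q, ‖q.1 - β • q.2.1‖ ^ k ∂(replicaLaw μ β) = ∫ z, ‖z‖ ^ k ∂(stdGaussian E) := by
  rw [← replicaLaw_map_noise μ β, integral_map (by fun_prop) (by fun_prop)]

theorem integrable_swap {g : E × E × E → ℝ} (hg : Integrable g (replicaLaw μ β)) :
    Integrable (fun q => g (q.1, q.2.2, q.2.1)) (replicaLaw μ β) := by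
  have h := hg
  rw [← replicaLaw_map_swap μ β] at h
  exact h.comp_measurable (f := fun q : E × E × E => (q.1, q.2.2, q.2.1)) (by fun_prop)

theorem integral_swap {g : E × E × E → ℝ} (hg : Measurable g) :
    ∫ q, g (q.1, q.2.2, q.2.1) ∂(replicaLaw μ β) = ∫ q, g q ∂(replicaLaw μ β) := by
  conv_rhs => rw [← replicaLaw_map_swap μ β]
  rw [integral_map (by fun_prop) hg.aestronglyMeasurable]

/-- Half the mean squared distance of two posterior draws, which is the minimal mean square error
of estimating `x` from `z + β x`. -/
def posteriorVariance : ℝ := (∫ q, ‖q.2.1 - q.2.2‖ ^ 2 ∂(replicaLaw μ β)) / 2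

omit [FiniteDimensional ℝ E] [MeasurableSpace E] [BorelSpace E] in
-- `β(x - x')` is the difference of the residuals `v - βx'` and `v - βx`, both standard Gaussian
-- under `replicaLaw`.
theorem norm_replica_le {β : ℝ} (hβ : 0 < β) (q : E × E × E) :
    ‖q.2.1 - q.2.2‖ ≤ (‖q.1 - β • q.2.1‖ + ‖q.1 - β • q.2.2‖) / β := by
  rw [le_div_iff₀ hβ]
  calc ‖q.2.1 - q.2.2‖ * β = ‖(q.1 - β • q.2.1) - (q.1 - β • q.2.2)‖ := by
        rw [sub_sub_sub_cancel_left, ← smul_sub, norm_smul, Real.norm_of_nonneg hβ.le, mul_comm,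
          norm_sub_rev]
    _ ≤ _ := norm_sub_le _ _

omit [FiniteDimensional ℝ E] [MeasurableSpace E] [BorelSpace E] in
theorem norm_replica_sq_le {β : ℝ} (hβ : 0 < β) (q : E × E × E) :
    ‖q.2.1 - q.2.2‖ ^ 2 ≤ 2 / β ^ 2 * (‖q.1 - β • q.2.1‖ ^ 2 + ‖q.1 - β • q.2.2‖ ^ 2) := by
  refine (pow_le_pow_left₀ (norm_nonneg _) (norm_replica_le hβ q) 2).trans ?_
  rw [div_pow, div_mul_eq_mul_div]
  refine div_le_div_of_nonneg_right ?_ (by positivity)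
  nlinarith [sq_nonneg (‖q.1 - β • q.2.1‖ - ‖q.1 - β • q.2.2‖)]

omit [FiniteDimensional ℝ E] [MeasurableSpace E] [BorelSpace E] in
theorem norm_replica_pow_four_le {β : ℝ} (hβ : 0 < β) (q : E × E × E) :
    ‖q.2.1 - q.2.2‖ ^ 4 ≤ 8 / β ^ 4 * (‖q.1 - β • q.2.1‖ ^ 4 + ‖q.1 - β • q.2.2‖ ^ 4) := by
  refine (pow_le_pow_left₀ (norm_nonneg _) (norm_replica_le hβ q) 4).trans ?_
  rw [div_pow, div_mul_eq_mul_div]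
  refine div_le_div_of_nonneg_right ?_ (by positivity)
  have := add_pow_le (norm_nonneg (q.1 - β • q.2.1)) (norm_nonneg (q.1 - β • q.2.2)) 4
  norm_num at this
  exact this

theorem integrable_noise_pow_add (k : ℕ) : Integrable (fun q : E × E × E =>
    ‖q.1 - β • q.2.1‖ ^ k + ‖q.1 - β • q.2.2‖ ^ k) (replicaLaw μ β) :=
  (integrable_noise_pow μ β k).add (integrable_swap μ β (integrable_noise_pow μ β k))

theorem integral_noise_pow_add (k : ℕ) :
    ∫ q, (‖q.1 - β • q.2.1‖ ^ k + ‖q.1 - β • q.2.2‖ ^ k) ∂(replicaLaw μ β) =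
      2 * ∫ z, ‖z‖ ^ k ∂(stdGaussian E) := by
  rw [integral_add (integrable_noise_pow μ β k)
    (integrable_swap μ β (integrable_noise_pow μ β k)), integral_swap μ β
    (g := fun q => ‖q.1 - β • q.2.1‖ ^ k) (by fun_prop), integral_noise_pow]
  ring

theorem integrable_replica_sq {β : ℝ} (hβ : 0 < β) :
    Integrable (fun q : E × E × E => ‖q.2.1 - q.2.2‖ ^ 2) (replicaLaw μ β) :=
  ((integrable_noise_pow_add μ β 2).const_mul (2 / β ^ 2)).mono' (by fun_prop)
    (.of_forall fun q => by
      rw [Real.norm_of_nonneg (by positivity)]; exact norm_replica_sq_le hβ q)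

theorem integrable_replica_pow_four {β : ℝ} (hβ : 0 < β) :
    Integrable (fun q : E × E × E => ‖q.2.1 - q.2.2‖ ^ 4) (replicaLaw μ β) :=
  ((integrable_noise_pow_add μ β 4).const_mul (8 / β ^ 4)).mono' (by fun_prop)
    (.of_forall fun q => by
      rw [Real.norm_of_nonneg (by positivity)]; exact norm_replica_pow_four_le hβ q)

omit [BorelSpace E] in
theorem posteriorVariance_nonneg : 0 ≤ posteriorVariance μ β :=
  div_nonneg (integral_nonneg fun _ => by positivity) (by norm_num)

theorem posteriorVariance_le {β : ℝ} (hβ : 0 < β) :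
    β ^ 2 * posteriorVariance μ β ≤ 2 * ∫ z, ‖z‖ ^ 2 ∂(stdGaussian E) := by
  have h := integral_mono (integrable_replica_sq μ hβ)
    ((integrable_noise_pow_add μ β 2).const_mul (2 / β ^ 2)) (norm_replica_sq_le hβ)
  rw [integral_const_mul, integral_noise_pow_add, div_mul_eq_mul_div,
    le_div_iff₀ (by positivity)] at h
  rw [posteriorVariance]
  linarith

/-- If the variance vanishes, then for some `v` the posterior sits at one point; `μ` has no more
mass elsewhere than the posterior, being absolutely continuous with respect to it. -/
theorem posteriorVariance_pos {β : ℝ} (hβ : 0 < β) (hμ : ∀ a, μ ≠ Measure.dirac a) :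
    0 < posteriorVariance μ β := by
  refine (posteriorVariance_nonneg μ β).lt_of_ne fun h => ?_
  have h0 : ∫ q, ‖q.2.1 - q.2.2‖ ^ 2 ∂(replicaLaw μ β) = 0 := by
    rw [posteriorVariance] at h; linarith
  rw [integral_eq_zero_iff_of_nonneg (fun _ => by positivity) (integrable_replica_sq μ hβ)] at h0
  have h1 := Measure.ae_ae_of_ae_compProd h0
  obtain ⟨v, hv⟩ := h1.exists
  rw [Kernel.prod_apply] at hv
  obtain ⟨x, hx⟩ := (Measure.ae_ae_of_ae_prod hv).exists
  have hx' : ∀ᵐ x' ∂μ, x' = x := by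
    refine (absolutelyContinuous_posterior μ β v).ae_le ?_
    filter_upwards [hx] with x' hx'
    have : ‖x - x'‖ = 0 := by simpa using hx'
    exact (sub_eq_zero.1 (norm_eq_zero.1 this)).symm
  refine hμ x ?_
  calc μ = μ.map id := Measure.map_id.symm
    _ = μ.map (fun _ => x) := Measure.map_congr hx'
    _ = Measure.dirac x := by rw [Measure.map_const]; simp

/-- Noise, data and one more posterior draw. -/
theorem map_noiseData_compProd :
    (noiseData μ ⊗ₘ (gaussPosterior μ β).comap (fun p : E × E => p.1 + β • p.2)
      (by fun_prop)).map (fun r => (r.1.1 + β • r.1.2, r.1.2, r.2)) = replicaLaw μ β := by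
  refine Measure.ext_of_lintegral _ fun F hF => ?_
  rw [lintegral_map hF (by fun_prop), Measure.lintegral_compProd (by fun_prop),
    ← lintegral_noiseData_posterior μ β hF]
  simp [Kernel.comap_apply]

theorem integrable_noiseData_compProd {F : E × E × E → ℝ} (hF : Integrable F (replicaLaw μ β)) :
    Integrable (fun r : (E × E) × E => F (r.1.1 + β • r.1.2, r.1.2, r.2))
      (noiseData μ ⊗ₘ (gaussPosterior μ β).comap (fun p : E × E => p.1 + β • p.2)
        (by fun_prop)) := by
  rw [← map_noiseData_compProd] at hF
  exact hF.comp_measurable (f := fun r : (E × E) × E => (r.1.1 + β • r.1.2, r.1.2, r.2))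
    (by fun_prop)

theorem integrable_posteriorMean {F : E × E × E → ℝ} (hF : Integrable F (replicaLaw μ β)) :
    Integrable (fun p => ∫ x', F (p.1 + β • p.2, p.2, x')
      ∂(gaussPosterior μ β (p.1 + β • p.2))) (noiseData μ) := by
  have h := integrable_noiseData_compProd μ β hF
  rw [Measure.compProd] at h
  simpa [Kernel.comap_apply] using Integrable.integral_compProd h

theorem integral_posteriorMean {F : E × E × E → ℝ} (hF : Integrable F (replicaLaw μ β)) :
    ∫ p, ∫ x', F (p.1 + β • p.2, p.2, x') ∂(gaussPosterior μ β (p.1 + β • p.2)) ∂(noiseData μ) =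
      ∫ q, F q ∂(replicaLaw μ β) := by
  have h := Measure.integral_compProd (integrable_noiseData_compProd μ β hF)
  simp only [Kernel.comap_apply] at h
  rw [← h]
  conv_rhs => rw [← map_noiseData_compProd]
  rw [integral_map (by fun_prop) (by rw [map_noiseData_compProd]; exact hF.1)]

/-- The integrand of the slope of the log-likelihood. -/
def slopeIntegrand (q : E × E × E) : ℝ := inner ℝ (q.1 - β • q.2.2) (q.2.1 - q.2.2)

@[fun_prop]
theorem measurable_slopeIntegrand : Measurable (slopeIntegrand β : E × E × E → ℝ) := by
  unfold slopeIntegrand; fun_prop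

omit [FiniteDimensional ℝ E] [MeasurableSpace E] [BorelSpace E] in
theorem abs_slopeIntegrand_le {β : ℝ} (hβ : 0 < β) (q : E × E × E) :
    |slopeIntegrand β q| ≤ 2 / β * (‖q.1 - β • q.2.1‖ ^ 2 + ‖q.1 - β • q.2.2‖ ^ 2) := by
  refine (abs_real_inner_le_norm _ _).trans ?_
  refine (mul_le_mul_of_nonneg_left (norm_replica_le hβ q) (norm_nonneg _)).trans ?_
  rw [mul_div_assoc', div_mul_eq_mul_div]
  refine div_le_div_of_nonneg_right ?_ hβ.le
  nlinarith [sq_nonneg (‖q.1 - β • q.2.1‖ - ‖q.1 - β • q.2.2‖), sq_nonneg ‖q.1 - β • q.2.1‖,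
    sq_nonneg ‖q.1 - β • q.2.2‖]

theorem integrable_slopeIntegrand {β : ℝ} (hβ : 0 < β) :
    Integrable (slopeIntegrand β) (replicaLaw μ β) :=
  ((integrable_noise_pow_add μ β 2).const_mul (2 / β)).mono' (by fun_prop)
    (.of_forall (abs_slopeIntegrand_le hβ))

/-- Symmetrisation: exchanging the two replicas preserves the mean, and the integrand plus its
swapped version is `β ‖x - x'‖²`. -/
theorem integral_slopeIntegrand {β : ℝ} (hβ : 0 < β) :
    ∫ q, slopeIntegrand β q ∂(replicaLaw μ β) = β * posteriorVariance μ β := by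
  have h1 := integral_swap μ β (measurable_slopeIntegrand β)
  have hi := integrable_slopeIntegrand μ hβ
  have h2 := integral_add hi (integrable_swap μ β hi)
  have h3 : ∀ q : E × E × E, slopeIntegrand β q + slopeIntegrand β (q.1, q.2.2, q.2.1) =
      β * ‖q.2.1 - q.2.2‖ ^ 2 := by
    intro q
    simp only [slopeIntegrand]
    rw [← neg_sub q.2.1 q.2.2, inner_neg_right, ← sub_eq_add_neg, ← inner_sub_left,
      sub_sub_sub_cancel_left, ← smul_sub, real_inner_smul_left, real_inner_self_eq_norm_sq]
  simp only [h3] at h2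
  rw [integral_const_mul, h1] at h2
  rw [posteriorVariance]
  linarith

theorem integral_logEvidenceSlope {β : ℝ} (hβ : 0 < β) :
    ∫ p, logEvidenceSlope μ β p ∂(noiseData μ) = -(β * posteriorVariance μ β) := by
  rw [← integral_slopeIntegrand μ hβ, ← integral_posteriorMean μ β
    (integrable_slopeIntegrand μ hβ), ← integral_neg]
  rfl

theorem integrable_logEvidenceSlope {β : ℝ} (hβ : 0 < β) :
    Integrable (logEvidenceSlope μ β) (noiseData μ) :=
  (integrable_posteriorMean μ β (integrable_slopeIntegrand μ hβ)).neg

theorem integral_abs_logEvidenceSlope_le {β : ℝ} (hβ : 0 < β) :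
    ∫ p, ‖logEvidenceSlope μ β p‖ ∂(noiseData μ) ≤
      4 / β * ∫ z, ‖z‖ ^ 2 ∂(stdGaussian E) := by
  have hi := integrable_slopeIntegrand μ hβ
  calc ∫ p, ‖logEvidenceSlope μ β p‖ ∂(noiseData μ)
      ≤ ∫ p, ∫ x', ‖slopeIntegrand β (p.1 + β • p.2, p.2, x')‖
        ∂(gaussPosterior μ β (p.1 + β • p.2)) ∂(noiseData μ) := by
        refine integral_mono (integrable_logEvidenceSlope μ hβ).norm
          (integrable_posteriorMean μ β hi.norm) fun p => ?_
        simp only [logEvidenceSlope, norm_neg]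
        exact norm_integral_le_integral_norm _
    _ = ∫ q, ‖slopeIntegrand β q‖ ∂(replicaLaw μ β) := integral_posteriorMean μ β hi.norm
    _ ≤ ∫ q, 2 / β * (‖q.1 - β • q.2.1‖ ^ 2 + ‖q.1 - β • q.2.2‖ ^ 2) ∂(replicaLaw μ β) :=
        integral_mono hi.norm ((integrable_noise_pow_add μ β 2).const_mul _)
          (abs_slopeIntegrand_le hβ)
    _ = _ := by rw [integral_const_mul, integral_noise_pow_add]; ring

theorem integrable_prod_logEvidenceSlope {a b : ℝ} (ha : 0 < a) :
    Integrable (fun q : ℝ × (E × E) => logEvidenceSlope μ q.1 q.2)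
      ((volume.restrict (Ioc a b)).prod (noiseData μ)) := by
  have hm := (measurable_logEvidenceSlope μ).aestronglyMeasurable
    (μ := (volume.restrict (Ioc a b)).prod (noiseData μ))
  rw [integrable_prod_iff hm]
  have hpos : ∀ᵐ β ∂volume.restrict (Ioc a b), a < β :=
    (ae_restrict_iff' measurableSet_Ioc).2 (.of_forall fun β hβ => hβ.1)
  refine ⟨hpos.mono fun β hβ => integrable_logEvidenceSlope μ (ha.trans hβ), ?_⟩
  refine Integrable.of_bound hm.norm.integral_prod_right'
    (4 / a * ∫ z, ‖z‖ ^ 2 ∂(stdGaussian E)) (hpos.mono fun β hβ => ?_)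
  rw [Real.norm_of_nonneg (integral_nonneg fun _ => norm_nonneg _)]
  refine (integral_abs_logEvidenceSlope_le μ (ha.trans hβ)).trans ?_
  exact mul_le_mul_of_nonneg_right (div_le_div_of_nonneg_left (by norm_num) ha hβ.le)
    (integral_nonneg fun _ => by positivity)

/-- The mean log-likelihood decreases in `β` at the rate `β · posteriorVariance`; no moments of `μ`
are needed. -/
theorem integrable_logEvidence_sub_and_integral {a b : ℝ} (ha : 0 < a) (hab : a ≤ b) :
    Integrable (fun p => logEvidence μ b p - logEvidence μ a p) (noiseData μ) ∧
    ∫ p, (logEvidence μ b p - logEvidence μ a p) ∂(noiseData μ) =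
      -∫ β in a..b, β * posteriorVariance μ β := by
  have hi := integrable_prod_logEvidenceSlope μ (b := b) ha
  have hae : (fun p => ∫ β in Ioc a b, logEvidenceSlope μ β p) =ᵐ[noiseData μ]
      fun p => logEvidence μ b p - logEvidence μ a p := by
    -- Fubini makes the slope integrable in `β` for almost every `p`, which is what the fundamental
    -- theorem of calculus needs.
    filter_upwards [hi.prod_left_ae] with p hp
    rw [← intervalIntegral.integral_of_le hab]
    refine intervalIntegral.integral_eq_sub_of_hasDerivAt
      (f := fun β => logEvidence μ β p) (fun β hβ => ?_)
      ((intervalIntegrable_iff_integrableOn_Ioc_of_le hab).2 hp)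
    rw [uIcc_of_le hab] at hβ
    exact hasDerivAt_logEvidence μ (ha.trans_le hβ.1) p
  refine ⟨hi.integral_prod_right.congr hae, ?_⟩
  rw [← integral_congr_ae hae, ← integral_integral_swap (f := fun β p => logEvidenceSlope μ β p) hi,
    intervalIntegral.integral_of_le hab, ← integral_neg]
  refine setIntegral_congr_fun measurableSet_Ioc fun β hβ => ?_
  exact integral_logEvidenceSlope μ (ha.trans hβ.1)

theorem continuous_posteriorMean_min (K : ℝ) (hK : 0 ≤ K) (p : E × E) :
    Continuous fun β : ℝ => ∫ x', min (‖p.2 - x'‖ ^ 2) K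
      ∂(gaussPosterior μ β (p.1 + β • p.2)) := by
  simp only [integral_posterior]
  refine Continuous.div ?_ ?_ fun β => (evidence_pos μ β _).ne'
  · refine continuous_of_dominated (bound := fun _ => K) (fun β => by fun_prop) ?_
      (integrable_const _) (.of_forall fun x' => by fun_prop)
    refine fun β => .of_forall fun x' => ?_
    have h0 : 0 ≤ min (‖p.2 - x'‖ ^ 2) K := le_min (by positivity) hK
    rw [Real.norm_of_nonneg (mul_nonneg (gaussWeight_pos _).le h0)]
    exact (mul_le_of_le_one_left h0 (gaussWeight_le_one _)).trans (min_le_right _ _)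
  · unfold evidence
    refine continuous_of_dominated (bound := fun _ => 1) (fun β => by fun_prop) ?_
      (integrable_const _) (.of_forall fun x' => by fun_prop)
    refine fun β => .of_forall fun x' => ?_
    rw [Real.norm_of_nonneg (gaussWeight_pos _).le]
    exact gaussWeight_le_one _

theorem integrable_replica_min (K : ℝ) (hK : 0 ≤ K) :
    Integrable (fun q : E × E × E => min (‖q.2.1 - q.2.2‖ ^ 2) K) (replicaLaw μ β) :=
  Integrable.of_bound (by fun_prop) K (.of_forall fun q => by
    rw [Real.norm_of_nonneg (le_min (by positivity) hK)]; exact min_le_right _ _)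

theorem continuous_integral_replica_min (K : ℝ) (hK : 0 ≤ K) :
    Continuous fun β : ℝ => ∫ q, min (‖q.2.1 - q.2.2‖ ^ 2) K ∂(replicaLaw μ β) := by
  simp only [← fun β => integral_posteriorMean μ β (integrable_replica_min μ β K hK)]
  refine continuous_of_dominated (bound := fun _ => K) (fun β => ?_) (fun β => ?_)
    (integrable_const _) (.of_forall (continuous_posteriorMean_min μ K hK))
  · exact (integrable_posteriorMean μ β (integrable_replica_min μ β K hK)).1
  · refine .of_forall fun p => ?_
    refine (norm_integral_le_of_norm_le_const (C := K) (.of_forall fun x' => ?_)).trans (by simp)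
    rw [Real.norm_of_nonneg (le_min (by positivity) hK)]
    exact min_le_right _ _

/-- On `[b, ∞)` the variance is a uniform limit of truncated ones. These are continuous by dominated
convergence, and the truncation error is at most a fourth moment over `K`, bounded by Gaussian
moments uniformly in `β ≥ b`. -/
theorem continuousOn_posteriorVariance : ContinuousOn (posteriorVariance μ) (Ioi 0) := by
  suffices h : ∀ b > 0, ContinuousOn (posteriorVariance μ) (Ici b) by
    intro β hβ
    have hβ : 0 < β := hβ
    exact ((h (β / 2) (half_pos hβ)).continuousAt (Ici_mem_nhds (by linarith))).continuousWithinAt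
  intro b hb
  refine continuousOn_of_uniform_approx_of_continuousOn fun u hu => ?_
  obtain ⟨ε, hε, hεu⟩ := Metric.mem_uniformity_dist.1 hu
  set G : ℝ := ∫ z, ‖z‖ ^ 4 ∂(stdGaussian E) with hG
  have hG0 : 0 ≤ G := integral_nonneg fun _ => by positivity
  -- The fourth moment is at most `16 G / b⁴`, and the factor `1/2` in `posteriorVariance` leaves `8
  -- G / b⁴`.
  obtain ⟨K, hK0, hK⟩ : ∃ K : ℝ, 0 < K ∧ 8 * G / b ^ 4 / K < ε := by
    refine ⟨8 * G / b ^ 4 / ε + 1, by positivity, ?_⟩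
    rw [div_lt_iff₀ (by positivity), mul_add, mul_div_cancel₀ _ hε.ne']
    linarith
  refine ⟨fun β => (∫ q, min (‖q.2.1 - q.2.2‖ ^ 2) K ∂(replicaLaw μ β)) / 2,
    ((continuous_integral_replica_min μ K hK0.le).div_const 2).continuousOn, fun β hβ => hεu ?_⟩
  have hβ0 : 0 < β := hb.trans_le hβ
  have hI2 := integrable_replica_sq μ hβ0
  have hIm := integrable_replica_min μ β K hK0.le
  have hlow : ∫ q, min (‖q.2.1 - q.2.2‖ ^ 2) K ∂(replicaLaw μ β) ≤
      ∫ q, ‖q.2.1 - q.2.2‖ ^ 2 ∂(replicaLaw μ β) :=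
    integral_mono hIm hI2 fun q => min_le_left _ _
  have hup : ∫ q, (‖q.2.1 - q.2.2‖ ^ 2 - min (‖q.2.1 - q.2.2‖ ^ 2) K) ∂(replicaLaw μ β) ≤
      ∫ q, ‖q.2.1 - q.2.2‖ ^ 4 / K ∂(replicaLaw μ β) := by
    refine integral_mono (hI2.sub hIm) ((integrable_replica_pow_four μ hβ0).div_const K)
      fun q => ?_
    simp only
    rw [le_div_iff₀ hK0]
    rcases min_cases (‖q.2.1 - q.2.2‖ ^ 2) K with ⟨h, -⟩ | ⟨h, h'⟩ <;> rw [h]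
    · rw [sub_self, zero_mul]; positivity
    · nlinarith [sq_nonneg (‖q.2.1 - q.2.2‖ ^ 2 - K)]
  have h4 : ∫ q, ‖q.2.1 - q.2.2‖ ^ 4 ∂(replicaLaw μ β) ≤ 8 / β ^ 4 * (2 * G) := by
    rw [hG, ← integral_noise_pow_add μ β 4, ← integral_const_mul]
    exact integral_mono (integrable_replica_pow_four μ hβ0)
      ((integrable_noise_pow_add μ β 4).const_mul _) (norm_replica_pow_four_le hβ0)
  have hb4 : 8 / β ^ 4 * (2 * G) ≤ 2 * (8 * G / b ^ 4) := by
    have : 8 / β ^ 4 ≤ 8 / b ^ 4 := div_le_div_of_nonneg_left (by norm_num) (by positivity)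
      (pow_le_pow_left₀ hb.le hβ 4)
    calc 8 / β ^ 4 * (2 * G) ≤ 8 / b ^ 4 * (2 * G) :=
          mul_le_mul_of_nonneg_right this (by positivity)
      _ = _ := by ring
  rw [integral_sub hI2 hIm, integral_div] at hup
  have hfin := div_le_div_of_nonneg_right (h4.trans hb4) hK0.le
  rw [mul_div_assoc] at hfin
  rw [Real.dist_eq, posteriorVariance, abs_of_nonneg (by linarith)]
  linarith

end GaussianChannel

end

/-! ### Conditional entropy through the Gaussian channel. -/

noncomputable section

section ChannelEntropy

variable {D : ℕ} {Ω : Type u} [MeasurableSpace Ω] {P : Measure Ω} [IsProbabilityMeasure P]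
  {U V : Ω → DataSpace D} {μ : Measure (DataSpace D)} [IsProbabilityMeasure μ] {β c : ℝ}

/-- The posterior of `U` given the scaled observation `V = c (z + β U)`. -/
abbrev scaledPosterior (μ : Measure (DataSpace D)) [IsProbabilityMeasure μ] (β c : ℝ) :
    Kernel (DataSpace D) (DataSpace D) :=
  (gaussPosterior μ β).comap (fun y => c⁻¹ • y) (by fun_prop)

theorem map_eq_compProd_scaledPosterior (hc : c ≠ 0) (hU : Measurable U)
    (hJ : P.map (fun ω => (V ω, U ω)) =
      (noiseData μ).map fun p => (c • (p.1 + β • p.2), p.2)) :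
    P.map (fun ω => (V ω, U ω)) = P.map V ⊗ₘ scaledPosterior μ β c := by
  have hV : P.map V = (obsLaw μ β).map (fun v => c • v) := by
    rw [← Measure.fst_map_prodMk (X := V) hU, hJ, Measure.fst_map_prodMk (by fun_prop), obsLaw,
      Measure.map_map (by fun_prop) (by fun_prop)]
    rfl
  refine Measure.ext_of_lintegral _ fun F hF => ?_
  have hm : Measurable fun y => ∫⁻ x, F (y, x) ∂(scaledPosterior μ β c y) :=
    Measurable.lintegral_kernel_prod_right' hF
  rw [Measure.lintegral_compProd hF, hV, lintegral_map hm (by fun_prop), hJ,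
    lintegral_map hF (by fun_prop)]
  simp only [Kernel.comap_apply, inv_smul_smul₀ hc]
  rw [← Measure.lintegral_compProd (f := fun q => F (c • q.1, q.2)) (by fun_prop),
    ← map_noiseData_eq_compProd, lintegral_map (by fun_prop) (by fun_prop)]

/-- The logarithm of the posterior density with respect to `ρ`. -/
def logPosteriorDensity (ρ μ : Measure (DataSpace D)) (β : ℝ) (v x : DataSpace D) : ℝ :=
  -‖v - β • x‖ ^ 2 / 2 - Real.log (evidence μ β v) + Real.log (μ.rnDeriv ρ x).toReal

theorem measurable_logPosteriorDensity (ρ : Measure (DataSpace D)) {α : Type*}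
    [MeasurableSpace α] {f g : α → DataSpace D} (hf : Measurable f) (hg : Measurable g) :
    Measurable fun a => logPosteriorDensity ρ μ β (f a) (g a) := by
  have h1 : Measurable fun a => Real.log (evidence μ β (f a)) :=
    ((measurable_evidence μ β).comp hf).log
  have h2 : Measurable fun a => Real.log (μ.rnDeriv ρ (g a)).toReal :=
    (((Measure.measurable_rnDeriv μ ρ).comp hg).ennreal_toReal).log
  have h3 : Measurable fun a => -‖f a - β • g a‖ ^ 2 / 2 := by fun_prop
  exact (h3.sub h1).add h2

/-- The density of the posterior is the tilting factor times that of `μ`, which exists since `μ` is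
dominated by the posterior. The latter is positive and finite almost everywhere, so the logarithm
splits. -/
theorem log_rnDeriv_posterior {ρ : Measure (DataSpace D)} [SigmaFinite ρ] {v : DataSpace D}
    (hac : gaussPosterior μ β v ≪ ρ) : ∀ᵐ x ∂(gaussPosterior μ β v),
      Real.log ((gaussPosterior μ β v).rnDeriv ρ x).toReal = logPosteriorDensity ρ μ β v x := by
  have hμ : μ ≪ ρ := (absolutelyContinuous_posterior μ β v).trans hac
  have h1 := toReal_rnDeriv_tilted_left (ν := ρ) μ (f := fun x => -‖v - β • x‖ ^ 2 / 2)
    (by fun_prop)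
  rw [← posterior_apply_tilted] at h1
  filter_upwards [hac.ae_le h1, (posterior_absolutelyContinuous μ β v).ae_le
    (Measure.rnDeriv_pos hμ), hac.ae_le (Measure.rnDeriv_lt_top μ ρ)] with x hx hpos hlt
  have hq : 0 < (μ.rnDeriv ρ x).toReal := ENNReal.toReal_pos hpos.ne' hlt.ne
  have hZ := evidence_pos μ β v
  rw [hx]
  change Real.log (Real.exp _ / evidence μ β v * _) = _
  rw [Real.log_mul (div_pos (Real.exp_pos _) hZ).ne' hq.ne', Real.log_div (Real.exp_pos _).ne'
    hZ.ne', Real.log_exp]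
  rfl

/-- The conditional entropy of the data given a Gaussian observation of it. -/
theorem HasCondEntropy.integrable_and_condEntropy_eq {ρ : Measure (DataSpace D)} [SigmaFinite ρ]
    (hc : c ≠ 0) (hU : Measurable U)
    (hJ : P.map (fun ω => (V ω, U ω)) =
      (noiseData μ).map fun p => (c • (p.1 + β • p.2), p.2))
    (hH : HasCondEntropy ρ P U V) :
    Integrable (fun p => -‖p.1‖ ^ 2 / 2 - logEvidence μ β p + Real.log (μ.rnDeriv ρ p.2).toReal)
      (noiseData μ) ∧
    condEntropy ρ P U V = -∫ p, (-‖p.1‖ ^ 2 / 2 - logEvidence μ β p +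
      Real.log (μ.rnDeriv ρ p.2).toReal) ∂(noiseData μ) := by
  have hcomp := map_eq_compProd_scaledPosterior hc hU hJ
  have hcd := condDistrib_ae_eq_of_measure_eq_compProd V hU.aemeasurable hcomp
  set L : DataSpace D × DataSpace D → ℝ := fun q => logPosteriorDensity ρ μ β (c⁻¹ • q.1) q.2
    with hL
  have hLm : Measurable L := 
    measurable_logPosteriorDensity ρ (by fun_prop) (by fun_prop)
  have hlog : ∀ᵐ y ∂(P.map V), condDistrib U V P y = scaledPosterior μ β c y ∧
      ∀ᵐ x ∂(scaledPosterior μ β c y), logCondDensity ρ P U V y x = L (y, x) := by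
    filter_upwards [hcd, hH.ac] with y hy hac
    refine ⟨hy, ?_⟩
    rw [hy] at hac
    filter_upwards [log_rnDeriv_posterior (v := c⁻¹ • y) hac] with x hx
    rw [logCondDensity, hy]
    exact hx
  have hLi : Integrable L (P.map V ⊗ₘ scaledPosterior μ β c) := by
    rw [Measure.integrable_compProd_iff hLm.aestronglyMeasurable]
    constructor
    · filter_upwards [hlog, hH.inner] with y hy hi
      rw [hy.1] at hi
      exact hi.congr hy.2
    · refine hH.outer.congr ?_
      filter_upwards [hlog] with y hy
      rw [hy.1]
      refine integral_congr_ae ?_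
      filter_upwards [hy.2] with x hx
      rw [hx, Real.norm_eq_abs]
  have hent : condEntropy ρ P U V = -∫ q, L q ∂(P.map V ⊗ₘ scaledPosterior μ β c) := by
    rw [Measure.integral_compProd hLi, condEntropy]
    congr 1
    refine integral_congr_ae ?_
    filter_upwards [hlog] with y hy
    rw [hy.1]
    exact integral_congr_ae hy.2
  -- In the variables noise and datum, the quadratic term and the prior density no longer depend on
  -- `β`.
  have hLp : ∀ p : DataSpace D × DataSpace D, L (c • (p.1 + β • p.2), p.2) =
      -‖p.1‖ ^ 2 / 2 - logEvidence μ β p + Real.log (μ.rnDeriv ρ p.2).toReal := by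
    intro p
    simp only [hL, logPosteriorDensity, logEvidence, inv_smul_smul₀ hc, add_sub_cancel_right]
  have hf : Measurable fun p : DataSpace D × DataSpace D => (c • (p.1 + β • p.2), p.2) := by
    fun_prop
  have hmeas := hcomp.symm.trans hJ
  rw [hmeas] at hLi hent
  rw [integral_map hf.aemeasurable hLm.aestronglyMeasurable] at hent
  have hLi' := (integrable_map_measure hLm.aestronglyMeasurable hf.aemeasurable).1 hLi
  refine ⟨hLi'.congr (.of_forall hLp), ?_⟩
  rw [hent]
  exact congrArg _ (integral_congr_ae (.of_forall hLp))

/-- The I-MMSE relation for conditional entropies, between two noise levels. -/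
theorem condEntropy_sub_condEntropy {Ω' : Type u} [MeasurableSpace Ω'] {P' : Measure Ω'}
    [IsProbabilityMeasure P'] {U' V' : Ω' → DataSpace D} {a b c' : ℝ} {ρ : Measure (DataSpace D)}
    [SigmaFinite ρ] (ha : 0 < a) (hab : a ≤ b) (hc : c ≠ 0) (hc' : c' ≠ 0)
    (hU : Measurable U) (hU' : Measurable U')
    (hJ : P.map (fun ω => (V ω, U ω)) =
      (noiseData μ).map fun p => (c • (p.1 + a • p.2), p.2))
    (hJ' : P'.map (fun ω => (V' ω, U' ω)) =
      (noiseData μ).map fun p => (c' • (p.1 + b • p.2), p.2))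
    (hH : HasCondEntropy ρ P U V) (hH' : HasCondEntropy ρ P' U' V') :
    condEntropy ρ P' U' V' - condEntropy ρ P U V = -∫ β in a..b, β * posteriorVariance μ β := by
  obtain ⟨hi, he⟩ := hH.integrable_and_condEntropy_eq hc hU hJ
  obtain ⟨hi', he'⟩ := hH'.integrable_and_condEntropy_eq hc' hU' hJ'
  -- The terms free of `β` cancel under one integral, so none of them has to be integrable by
  -- itself.
  rw [he, he', ← (integrable_logEvidence_sub_and_integral μ ha hab).2, neg_sub_neg,
    ← integral_sub hi hi']
  refine integral_congr_ae (.of_forall fun p => ?_)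
  simp only
  ring

end ChannelEntropy

end

/-! ### Riemann sums against an integrable weight. -/

noncomputable section

section RiemannSums

open Filter Topology

/-- The `i`-th point of the equidistant grid of `[0, t]` with `n` intervals. -/
def gridPoint (t : ℝ) (n i : ℕ) : ℝ := i * (t / n)

@[simp] theorem gridPoint_zero (t : ℝ) (n : ℕ) : gridPoint t n 0 = 0 := by simp [gridPoint]

theorem gridPoint_self (t : ℝ) {n : ℕ} (hn : n ≠ 0) : gridPoint t n n = t := by
  have : (n : ℝ) ≠ 0 := by exact_mod_cast hn
  rw [gridPoint]; field_simp

theorem gridPoint_succ (t : ℝ) (n i : ℕ) : gridPoint t n (i + 1) = gridPoint t n i + t / n := by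
  simp only [gridPoint]; push_cast; ring

theorem gridPoint_mono {t : ℝ} (ht : 0 ≤ t) (n : ℕ) : Monotone (gridPoint t n) := fun i j hij =>
  mul_le_mul_of_nonneg_right (by exact_mod_cast hij) (by positivity)

theorem gridPoint_mem {t : ℝ} (ht : 0 ≤ t) {n i : ℕ} (hi : i ≤ n) : gridPoint t n i ∈ Icc 0 t := by
  rcases Nat.eq_zero_or_pos n with rfl | hn
  · simp [gridPoint, ht]
  · refine ⟨by rw [← gridPoint_zero t n]; exact gridPoint_mono ht n i.zero_le, ?_⟩
    exact (gridPoint_mono ht n hi).trans_eq (gridPoint_self t hn.ne')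

theorem gridPoint_lt_succ {t : ℝ} (ht : 0 < t) {n i : ℕ} (hi : i < n) :
    gridPoint t n i < gridPoint t n (i + 1) := by
  rw [gridPoint_succ]
  have : (0 : ℝ) < n := by exact_mod_cast (Nat.zero_le i).trans_lt hi
  have : 0 < t / n := by positivity
  linarith

theorem abs_sub_gridPoint_le {t : ℝ} {n i : ℕ} {v : ℝ}
    (hv : v ∈ Ioc (gridPoint t n i) (gridPoint t n (i + 1))) :
    |v - gridPoint t n i| ≤ t / n ∧ |gridPoint t n (i + 1) - v| ≤ t / n := by
  rw [gridPoint_succ] at hv ⊢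
  obtain ⟨h1, h2⟩ := hv
  constructor <;> rw [abs_le] <;> constructor <;> linarith

variable {F : Type*} [NormedAddCommGroup F]

theorem intervalIntegrable_of_mem {a : ℝ → F} {t u v : ℝ} (ha : IntervalIntegrable a volume 0 t)
    (hu : u ∈ Icc 0 t) (hv : v ∈ Icc 0 t) : IntervalIntegrable a volume u v := by
  refine ha.mono_set ?_
  rw [uIcc_of_le (hu.1.trans hu.2)]
  exact ordConnected_Icc.uIcc_subset hu hv

variable [NormedSpace ℝ F]

/-- Riemann sums of an integrable weight against increments of a continuous function `K` over
vanishing distances converge to zero. -/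
theorem tendsto_sum_integral_smul_sub {a : ℝ → ℝ} {t : ℝ} (ht : 0 < t)
    (ha : IntervalIntegrable a volume 0 t) {K : ℝ × ℝ → F}
    (hK : ContinuousOn K (Icc 0 t ×ˢ Icc 0 t)) (p q : ℕ → ℕ → ℝ → ℝ × ℝ)
    (hpq : ∀ n i, i < n → ∀ v ∈ Ioc (gridPoint t n i) (gridPoint t n (i + 1)),
      p n i v ∈ Icc 0 t ×ˢ Icc 0 t ∧ q n i v ∈ Icc 0 t ×ˢ Icc 0 t ∧
        dist (p n i v) (q n i v) ≤ t / n) :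
    Tendsto (fun n => ∑ i ∈ Finset.range n, ∫ v in (gridPoint t n i)..(gridPoint t n (i + 1)),
      a v • (K (p n i v) - K (q n i v))) atTop (𝓝 0) := by
  have hunif := (isCompact_Icc.prod isCompact_Icc).uniformContinuousOn_of_continuous hK
  rw [Metric.uniformContinuousOn_iff_le] at hunif
  set A := ∫ v in (0 : ℝ)..t, ‖a v‖ with hA
  have hA0 : 0 ≤ A := intervalIntegral.integral_nonneg ht.le fun _ _ => norm_nonneg _
  rw [Metric.tendsto_atTop]
  intro ε hε
  -- The `+ 1` covers `A = 0` and makes the final bound strict.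
  obtain ⟨δ, hδ, hd⟩ := hunif (ε / (A + 1)) (by positivity)
  obtain ⟨N, hN⟩ := exists_nat_gt (t / δ)
  refine ⟨N, fun n hn => ?_⟩
  have hNpos : (0 : ℝ) < N := (div_pos ht hδ).trans hN
  have hnN : (N : ℝ) ≤ n := by exact_mod_cast hn
  have hn0 : (0 : ℝ) < n := hNpos.trans_le hnN
  have hn0' : n ≠ 0 := by rintro rfl; simp at hn0
  have htn : t / n ≤ δ := by
    rw [div_le_iff₀ hn0, ← div_le_iff₀' hδ]
    exact hN.le.trans hnN
  have hint : ∀ k < n, IntervalIntegrable (fun v => ‖a v‖) volume (gridPoint t n k)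
      (gridPoint t n (k + 1)) := fun k hk =>
    intervalIntegrable_of_mem ha.norm (gridPoint_mem ht.le hk.le) (gridPoint_mem ht.le hk)
  rw [dist_zero_right]
  calc ‖∑ i ∈ Finset.range n, ∫ v in (gridPoint t n i)..(gridPoint t n (i + 1)),
        a v • (K (p n i v) - K (q n i v))‖
      ≤ ∑ i ∈ Finset.range n, ∫ v in (gridPoint t n i)..(gridPoint t n (i + 1)),
        ‖a v‖ * (ε / (A + 1)) := by
        refine (norm_sum_le _ _).trans (Finset.sum_le_sum fun i hi => ?_)
        have hi := Finset.mem_range.1 hi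
        refine intervalIntegral.norm_integral_le_of_norm_le (gridPoint_lt_succ ht hi).le
          (.of_forall fun v hv => ?_) ((hint i hi).mul_const _)
        obtain ⟨h1, h2, h3⟩ := hpq n i hi v hv
        rw [norm_smul, ← dist_eq_norm]
        exact mul_le_mul_of_nonneg_left (hd _ h1 _ h2 (h3.trans htn)) (norm_nonneg _)
    _ = A * (ε / (A + 1)) := by
        simp only [intervalIntegral.integral_mul_const]
        rw [← Finset.sum_mul, intervalIntegral.sum_integral_adjacent_intervals hint,
          gridPoint_zero, gridPoint_self t hn0']
    _ < ε := by
        rw [mul_div_assoc', div_lt_iff₀ (by positivity)]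
        nlinarith

theorem Ioc_gridPoint_subset {t : ℝ} (ht : 0 ≤ t) {n i : ℕ} (hi : i < n) :
    Ioc (gridPoint t n i) (gridPoint t n (i + 1)) ⊆ Icc 0 t := fun _ hv =>
  ⟨(gridPoint_mem ht hi.le).1.trans hv.1.le, hv.2.trans (gridPoint_mem ht hi).2⟩

/-- Left Riemann sums of a continuous function against an integrable weight. -/
theorem tendsto_sum_integral_smul [CompleteSpace F] {a : ℝ → ℝ} {t : ℝ} (ht : 0 < t)
    (ha : IntervalIntegrable a volume 0 t) {x : ℝ → F} (hx : ContinuousOn x (Icc 0 t)) :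
    Tendsto (fun n => ∑ i ∈ Finset.range n,
      (∫ v in (gridPoint t n i)..(gridPoint t n (i + 1)), a v) • x (gridPoint t n i)) atTop
      (𝓝 (∫ v in (0 : ℝ)..t, a v • x v)) := by
  have hK : ContinuousOn (fun p : ℝ × ℝ => x p.1) (Icc 0 t ×ˢ Icc 0 t) :=
    hx.comp continuousOn_fst fun p hp => hp.1
  have hax : IntervalIntegrable (fun v => a v • x v) volume 0 t :=
    ha.smul_continuousOn (by rwa [uIcc_of_le ht.le])
  have h := tendsto_sum_integral_smul_sub ht ha hK (fun n i v => (v, v))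
    (fun n i v => (gridPoint t n i, v)) (fun n i hi v hv => by
      have hv' := Ioc_gridPoint_subset ht.le hi hv
      refine ⟨⟨hv', hv'⟩, ⟨gridPoint_mem ht.le hi.le, hv'⟩, ?_⟩
      rw [Prod.dist_eq, dist_self, max_eq_left dist_nonneg]
      exact (abs_sub_gridPoint_le hv).1)
  have h' := (tendsto_const_nhds (x := ∫ v in (0 : ℝ)..t, a v • x v)).sub h
  rw [sub_zero] at h'
  refine h'.congr' ?_
  filter_upwards [eventually_ne_atTop 0] with n hn
  have hint : ∀ k < n, IntervalIntegrable (fun v => a v • x v) volume (gridPoint t n k)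
      (gridPoint t n (k + 1)) := fun k hk =>
    intervalIntegrable_of_mem hax (gridPoint_mem ht.le hk.le) (gridPoint_mem ht.le hk)
  have hsum := intervalIntegral.sum_integral_adjacent_intervals hint
  rw [gridPoint_zero, gridPoint_self t hn] at hsum
  rw [← hsum, ← Finset.sum_sub_distrib]
  refine Finset.sum_congr rfl fun i hi => ?_
  have hi := Finset.mem_range.1 hi
  have hai := intervalIntegrable_of_mem ha (gridPoint_mem ht.le hi.le) (gridPoint_mem ht.le hi)
  simp only [smul_sub]
  rw [intervalIntegral.integral_sub (hint i hi) (hai.smul_continuousOn continuousOn_const),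
    intervalIntegral.integral_smul_const]
  abel

end RiemannSums

/-! ### Calculus of the schedules. -/

namespace NoiseSchedule.IsAdmissible

variable {A : NoiseSchedule}

theorem scale_pos' (hA : A.IsAdmissible) {t : ℝ} (ht : t ∈ insert 0 A.time) : 0 < A.scale t := by
  rcases ht with rfl | ht
  · rw [hA.scale_zero]; exact one_pos
  · exact hA.scale_pos t ht

theorem scale_continuousOn_Icc (hA : A.IsAdmissible) {t : ℝ} (ht : t ∈ A.time) :
    ContinuousOn A.scale (Icc 0 t) :=
  hA.scale_continuousOn.mono (hA.forward.Icc_subset ht)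

theorem sigma_continuousOn_Icc (hA : A.IsAdmissible) {t : ℝ} (ht : t ∈ A.time) :
    ContinuousOn A.sigma (Icc 0 t) :=
  hA.sigma_continuousOn.mono (hA.forward.Icc_subset ht)

theorem inv_scale_continuousOn (hA : A.IsAdmissible) {t : ℝ} (ht : t ∈ A.time) :
    ContinuousOn (fun v => (A.scale v)⁻¹) (Icc 0 t) :=
  (hA.scale_continuousOn_Icc ht).inv₀ fun _ hv => (hA.scale_pos' (hA.forward.Icc_subset ht hv)).ne'

theorem hasDerivAt_scale (hA : A.IsAdmissible) {t v : ℝ} (ht : t ∈ A.time) (hv : v ∈ Ioo 0 t) :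
    HasDerivAt A.scale (derivWithin A.scale A.time v) v :=
  hA.forward.hasDerivAt hA.scale_differentiableOn ht hv

theorem hasDerivAt_sigma (hA : A.IsAdmissible) {t v : ℝ} (ht : t ∈ A.time) (hv : v ∈ Ioo 0 t) :
    HasDerivAt A.sigma (derivWithin A.sigma A.time v) v :=
  hA.forward.hasDerivAt hA.sigma_differentiableOn ht hv

theorem sigma_strictMonoOn (hA : A.IsAdmissible) : StrictMonoOn A.sigma (insert 0 A.time) := by
  intro a ha b hb hab
  have hb' : b ∈ A.time := IsForwardTime.mem_of_pos hb ((hA.forward.nonneg ha).trans_lt hab)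
  have h0 := hA.forward.pos b hb'
  refine strictMonoOn_of_deriv_pos (convex_Icc 0 b) (hA.sigma_continuousOn_Icc hb')
    (fun x hx => ?_) ⟨hA.forward.nonneg ha, hab.le⟩ (right_mem_Icc.2 h0.le) hab
  rw [interior_Icc] at hx
  rw [(hA.hasDerivAt_sigma hb' hx).deriv]
  exact hA.sigma_deriv_pos x (hA.forward.down b hb' ⟨hx.1, hx.2.le⟩)

theorem sigma_pos (hA : A.IsAdmissible) {t : ℝ} (ht : t ∈ A.time) : 0 < A.sigma t := by
  have := hA.sigma_strictMonoOn (mem_insert 0 _) (Or.inr ht) (hA.forward.pos t ht)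
  rwa [hA.sigma_zero] at this

/-- The drift coefficient `s' / s` is integrable. -/
theorem intervalIntegrable_rate (hA : A.IsAdmissible) {t : ℝ} (ht : t ∈ A.time) :
    IntervalIntegrable (fun v => derivWithin A.scale A.time v / A.scale v) volume 0 t := by
  have h0 := (hA.forward.pos t ht).le
  have h := (intervalIntegrable_iff_integrableOn_Ioc_of_le h0).2 (hA.scale_deriv_integrable t ht)
  have := h.mul_continuousOn (g := fun v => (A.scale v)⁻¹)
    (by rw [uIcc_of_le h0]; exact hA.inv_scale_continuousOn ht)
  simpa only [div_eq_mul_inv] using this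

theorem integral_rate_mul_inv (hA : A.IsAdmissible) {t u v : ℝ} (ht : t ∈ A.time)
    (hu : 0 ≤ u) (huv : u ≤ v) (hv : v ≤ t) :
    ∫ r in u..v, derivWithin A.scale A.time r / A.scale r * (A.scale r)⁻¹ =
      (A.scale u)⁻¹ - (A.scale v)⁻¹ := by
  have h0 := (hA.forward.pos t ht).le
  have hi : IntervalIntegrable (fun r => derivWithin A.scale A.time r / A.scale r *
      (A.scale r)⁻¹) volume u v :=
    intervalIntegrable_of_mem ((hA.intervalIntegrable_rate ht).mul_continuousOn
      (by rw [uIcc_of_le h0]; exact hA.inv_scale_continuousOn ht)) ⟨hu, huv.trans hv⟩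
      ⟨hu.trans huv, hv⟩
  have hftc := intervalIntegral.integral_eq_sub_of_hasDerivAt_of_le huv
    (f := fun r => -(A.scale r)⁻¹)
    (((hA.inv_scale_continuousOn ht).mono (Icc_subset_Icc hu hv)).neg) (fun r hr => ?_) hi
  · rw [hftc]; ring
  · have hr' : r ∈ Ioo 0 t := ⟨hu.trans_lt hr.1, hr.2.trans_le hv⟩
    have hp := hA.scale_pos r (hA.forward.down t ht ⟨hr'.1, hr'.2.le⟩)
    refine ((hA.hasDerivAt_scale ht hr').inv hp.ne').neg.congr_deriv ?_
    field_simp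

/-- A nonnegative derivative of a continuous function is integrable, so integrability has to be
assumed only for the scale. -/
theorem intervalIntegrable_sigma_deriv (hA : A.IsAdmissible) {t : ℝ} (ht : t ∈ A.time) :
    IntervalIntegrable (derivWithin A.sigma A.time) volume 0 t := by
  have h0 := (hA.forward.pos t ht).le
  refine intervalIntegral.intervalIntegrable_deriv_of_nonneg (g := A.sigma)
    (by rw [uIcc_of_le h0]; exact hA.sigma_continuousOn_Icc ht) ?_ ?_
  all_goals
    rw [min_eq_left h0, max_eq_right h0]
    intro x hx
  · exact hA.hasDerivAt_sigma ht hx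
  · exact (hA.sigma_deriv_pos x (hA.forward.down t ht ⟨hx.1, hx.2.le⟩)).le

theorem vol_sq (hA : A.IsAdmissible) (D : ℕ) {v : ℝ} (hv : v ∈ A.time) :
    (A.toSDE D).vol v ^ 2 =
      A.scale v ^ 2 * (2 * derivWithin A.sigma A.time v * A.sigma v) := by
  simp only [NoiseSchedule.toSDE]
  rw [mul_pow, Real.sq_sqrt]
  have := hA.sigma_deriv_pos v hv
  have := hA.sigma_pos hv
  positivity

/-- The integrand is `2 σ σ'`, the derivative of `σ²`. -/
theorem integral_vol_sq_div (hA : A.IsAdmissible) (D : ℕ) {t : ℝ} (ht : t ∈ A.time) :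
    ∫ v in (0 : ℝ)..t, (A.toSDE D).vol v ^ 2 * ((A.scale v)⁻¹) ^ 2 = A.sigma t ^ 2 := by
  have h0 := (hA.forward.pos t ht).le
  have hi : IntervalIntegrable (fun v => derivWithin A.sigma A.time v * (2 * A.sigma v)) volume 0 t :=
    (hA.intervalIntegrable_sigma_deriv ht).mul_continuousOn
      (by rw [uIcc_of_le h0]; exact (hA.sigma_continuousOn_Icc ht).const_mul 2)
  have h := intervalIntegral.integral_eq_sub_of_hasDerivAt_of_le h0
    (f := fun v => A.sigma v ^ 2) ((hA.sigma_continuousOn_Icc ht).pow 2) (fun r hr => ?_) hi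
  · rw [hA.sigma_zero] at h
    simp only [ne_eq, OfNat.ofNat_ne_zero, not_false_eq_true, zero_pow, sub_zero] at h
    rw [← h]
    refine intervalIntegral.integral_congr_ae (.of_forall fun v hv => ?_)
    rw [uIoc_of_le h0] at hv
    have hv := hA.forward.down t ht hv
    have := (hA.scale_pos v hv).ne'
    rw [hA.vol_sq D hv]
    field_simp
  · refine ((hA.hasDerivAt_sigma ht hr).pow 2).congr_deriv ?_
    push_cast
    ring

end NoiseSchedule.IsAdmissible

end

/-! ### The forward kernel of the linear SDE. -/

noncomputable section

open Filter Topology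

/-- The left-point sums of a function `N` against a weight `r` over the equidistant grid. -/
def gridSum {F : Type*} [AddCommGroup F] [Module ℝ F] (r : ℝ → ℝ) (N : ℝ → F) (t : ℝ)
    (n k : ℕ) : F :=
  ∑ i ∈ Finset.range k, r (gridPoint t n i) • (N (gridPoint t n (i + 1)) - N (gridPoint t n i))

namespace NoiseSchedule.IsAdmissible

variable {A : NoiseSchedule} {D : ℕ}

/-- Integration by parts for `d(x / s)`: the sums of `s⁻¹ dN` converge to `x / s - x_0`. -/
theorem tendsto_gridSum (hA : A.IsAdmissible) {t : ℝ} (ht : t ∈ A.time)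
    {x : ℝ → DataSpace D} (hx : ContinuousOn x (Icc 0 t)) :
    Tendsto (fun n => gridSum (fun v => (A.scale v)⁻¹) (fun v => x v - x 0 -
      ∫ u in (0 : ℝ)..v, (derivWithin A.scale A.time u / A.scale u) • x u) t n n) atTop
      (𝓝 ((A.scale t)⁻¹ • x t - x 0)) := by
  have h0 := hA.forward.pos t ht
  set a : ℝ → ℝ := fun u => derivWithin A.scale A.time u / A.scale u with ha
  set r : ℝ → ℝ := fun v => (A.scale v)⁻¹ with hr
  have hrc : ContinuousOn r (Icc 0 t) := hA.inv_scale_continuousOn ht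
  have hai : IntervalIntegrable a volume 0 t := hA.intervalIntegrable_rate ht
  have hax : IntervalIntegrable (fun v => a v • x v) volume 0 t :=
    hai.smul_continuousOn (by rwa [uIcc_of_le h0.le])
  have har : IntervalIntegrable (fun v => a v * r v) volume 0 t :=
    hai.mul_continuousOn (by rwa [uIcc_of_le h0.le])
  -- With `r = 1/s` and `r' = -a r`, one summand of `gridSum` is the increment of `r x` minus `∫
  -- a(v) (r_i x_v - r_v x_{i+1}) dv` over the grid interval. The bracket compares values of `K` at
  -- points one mesh width apart, so these errors sum to zero in the limit.
  have hK : ContinuousOn (fun p : ℝ × ℝ => r p.2 • x p.1) (Icc 0 t ×ˢ Icc 0 t) :=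
    (hrc.comp continuousOn_snd fun p hp => hp.2).smul (hx.comp continuousOn_fst fun p hp => hp.1)
  have h := tendsto_sum_integral_smul_sub h0 hai hK (fun n i v => (v, gridPoint t n i))
    (fun n i v => (gridPoint t n (i + 1), v)) (fun n i hi v hv => by
      have hv' := Ioc_gridPoint_subset h0.le hi hv
      refine ⟨⟨hv', gridPoint_mem h0.le hi.le⟩, ⟨gridPoint_mem h0.le hi, hv'⟩, ?_⟩
      have h1 := abs_sub_gridPoint_le hv
      rw [Prod.dist_eq, Real.dist_eq, Real.dist_eq]
      exact max_le (by rw [abs_sub_comm]; exact h1.2) (by rw [abs_sub_comm]; exact h1.1))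
  have h' := (tendsto_const_nhds (x := r t • x t - x 0)).sub h
  rw [sub_zero] at h'
  refine h'.congr' ?_
  filter_upwards [eventually_ne_atTop 0] with n hn
  have htel := Finset.sum_range_sub (fun i => r (gridPoint t n i) • x (gridPoint t n i)) n
  rw [gridPoint_self t hn, gridPoint_zero, show r 0 = 1 by simp [hr, hA.scale_zero],
    one_smul] at htel
  rw [← htel, gridSum, ← Finset.sum_sub_distrib]
  refine Finset.sum_congr rfl fun i hi => ?_
  have hi := Finset.mem_range.1 hi
  have hm := gridPoint_mem h0.le hi.le
  have hm' := gridPoint_mem h0.le (show i + 1 ≤ n from hi)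
  have hle := (gridPoint_lt_succ h0 hi).le
  have hr' := hA.integral_rate_mul_inv ht hm.1 hle hm'.2
  have hax' := intervalIntegrable_of_mem hax hm hm'
  have har' := intervalIntegrable_of_mem har hm hm'
  have hz : (0 : ℝ) ∈ Icc 0 t := left_mem_Icc.2 h0.le
  have hadd := intervalIntegral.integral_interval_sub_left
    (intervalIntegrable_of_mem hax hz hm') (intervalIntegrable_of_mem hax hz hm)
  have hint : ∫ v in (gridPoint t n i)..(gridPoint t n (i + 1)),
      a v • (r (gridPoint t n i) • x v - r v • x (gridPoint t n (i + 1))) =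
      r (gridPoint t n i) • (∫ v in (gridPoint t n i)..(gridPoint t n (i + 1)), a v • x v) -
      (r (gridPoint t n i) - r (gridPoint t n (i + 1))) • x (gridPoint t n (i + 1)) := by
    have h1 : IntervalIntegrable (fun v => r (gridPoint t n i) • a v • x v) volume
      (gridPoint t n i) (gridPoint t n (i + 1)) := by
      simpa only [Pi.smul_def] using hax'.smul (r (gridPoint t n i))
    have h2 : IntervalIntegrable (fun v => (a v * r v) • x (gridPoint t n (i + 1))) volume
      (gridPoint t n i) (gridPoint t n (i + 1)) := har'.smul_continuousOn continuousOn_const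
    rw [← hr', ← intervalIntegral.integral_smul, ← intervalIntegral.integral_smul_const,
      ← intervalIntegral.integral_sub h1 h2]
    refine intervalIntegral.integral_congr fun v _ => ?_
    simp only [smul_sub, smul_smul, mul_comm, ha]
  rw [hint, ← hadd]
  module

theorem tendsto_gridVariance (hA : A.IsAdmissible) (D : ℕ) {t : ℝ} (ht : t ∈ A.time)
    (hvol : IntegrableOn (fun v => (A.toSDE D).vol v ^ 2) (Ioc 0 t)) :
    Tendsto (fun n => ∑ i ∈ Finset.range n,
      (∫ v in (gridPoint t n i)..(gridPoint t n (i + 1)), (A.toSDE D).vol v ^ 2) *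
        ((A.scale (gridPoint t n i))⁻¹) ^ 2) atTop (𝓝 (A.sigma t ^ 2)) := by
  have h0 := hA.forward.pos t ht
  rw [← hA.integral_vol_sq_div D ht]
  exact tendsto_sum_integral_smul h0 ((intervalIntegrable_iff_integrableOn_Ioc_of_le h0.le).2 hvol)
    ((hA.inv_scale_continuousOn ht).pow 2)

end NoiseSchedule.IsAdmissible

section Past

variable {D : ℕ} {Ω : Type u}

/-- The σ-algebra generated by the process up to time `r`. -/
@[reducible]
def pastSigma (T : Set ℝ) (X : ℝ → Ω → DataSpace D) (r : ℝ) : MeasurableSpace Ω :=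
  ⨆ v ∈ {v | v ∈ insert 0 T ∧ v ≤ r}, MeasurableSpace.comap (X v) inferInstance

variable {T : Set ℝ} {X : ℝ → Ω → DataSpace D}

theorem pastSigma_mono : Monotone (pastSigma T X) := fun _ _ h =>
  iSup₂_le fun v hv => le_iSup₂_of_le v ⟨hv.1, hv.2.trans h⟩ le_rfl

theorem measurable_pastSigma {v r : ℝ} (hv : v ∈ insert 0 T) (hvr : v ≤ r) :
    Measurable[pastSigma T X r] (X v) :=
  measurable_iff_comap_le.2 (le_iSup₂_of_le (f := fun v (_ : v ∈ {v | v ∈ insert 0 T ∧ v ≤ r}) =>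
    MeasurableSpace.comap (X v) inferInstance) v ⟨hv, hvr⟩ le_rfl)

theorem pastSigma_le [m : MeasurableSpace Ω] (hX : ∀ v ∈ insert 0 T, Measurable (X v)) (r : ℝ) :
    pastSigma T X r ≤ m :=
  iSup₂_le fun v hv => (hX v hv.1).comap_le

/-- The σ-algebra `m` need not contain the null sets, so an almost sure limit is only known to have
an `m`-measurable version; `limUnder` provides one. -/
theorem exists_measurable_of_tendsto_ae {m m₀ : MeasurableSpace Ω} {P : Measure[m₀] Ω}
    {f : ℕ → Ω → DataSpace D} {g : Ω → DataSpace D} (hf : ∀ n, Measurable[m] (f n))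
    (h : ∀ᵐ ω ∂P, Tendsto (fun n => f n ω) atTop (𝓝 (g ω))) :
    ∃ g', Measurable[m] g' ∧ g =ᵐ[P] g' := by
  refine ⟨fun ω => limUnder atTop fun n => f n ω,
    (@StronglyMeasurable.limUnder ℕ Ω (DataSpace D) m _ _ _ _ f _ _
      fun n => (hf n).stronglyMeasurable).measurable, ?_⟩
  filter_upwards [h] with ω hω
  exact hω.limUnder_eq.symm

theorem measurable_sum_smul {m : MeasurableSpace Ω} (n : ℕ) (c : ℕ → ℝ)
    {f : ℕ → Ω → DataSpace D} (hf : ∀ i < n, Measurable (f i)) :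
    Measurable fun ω => ∑ i ∈ Finset.range n, c i • f i ω :=
  Finset.measurable_fun_sum _ fun i hi => (hf i (Finset.mem_range.1 hi)).const_smul (c i)

end Past

section LinearSDE

variable {A : NoiseSchedule} {D : ℕ} {Ω : Type u} [MeasurableSpace Ω] {P : Measure Ω}
  [IsProbabilityMeasure P] {p₀ : Measure (DataSpace D)} {X : ℝ → Ω → DataSpace D}

omit [IsProbabilityMeasure P] in
-- Along continuous paths the drift integral is a limit of Riemann sums of past values. Hence
-- earlier noise belongs to the past, up to null sets, and is independent of later increments.
theorem NoiseSchedule.IsAdmissible.noise_ae_eq (hA : A.IsAdmissible)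
    (hX : (A.toSDE D).IsSolution p₀ P X) {r : ℝ} (hr : r ∈ insert 0 A.time) :
    ∃ g, Measurable[pastSigma A.time X r] g ∧ (A.toSDE D).noise X r =ᵐ[P] g := by
  rcases hr with rfl | hr
  · refine ⟨fun _ => 0, measurable_const, .of_forall fun ω => ?_⟩
    simp [DiffusionSDE.noise]
  have h0 := hA.forward.pos r hr
  set a : ℝ → ℝ := fun u => derivWithin A.scale A.time u / A.scale u with ha
  refine exists_measurable_of_tendsto_ae (m := pastSigma A.time X r)
    (f := fun n ω => X r ω - X 0 ω - ∑ i ∈ Finset.range n,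
      (∫ v in (gridPoint r n i)..(gridPoint r n (i + 1)), a v) • X (gridPoint r n i) ω)
    (fun n => ?_) ?_
  · refine ((measurable_pastSigma (Or.inr hr) le_rfl).sub
      (measurable_pastSigma (mem_insert 0 _) h0.le)).sub (measurable_sum_smul n
        (fun i => ∫ v in (gridPoint r n i)..(gridPoint r n (i + 1)), a v) fun i hi => ?_)
    have hm := gridPoint_mem h0.le hi.le
    exact measurable_pastSigma (hA.forward.Icc_subset hr hm) hm.2
  · filter_upwards [hX.continuous_paths] with ω hω
    have hc : ContinuousOn (fun v => X v ω) (Icc 0 r) := hω.mono (hA.forward.Icc_subset hr)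
    have h := tendsto_sum_integral_smul h0 (hA.intervalIntegrable_rate hr) hc
    exact (tendsto_const_nhds (x := X r ω - X 0 ω)).sub h

theorem measurable_cexp_inner_add {Ω : Type*} {m : MeasurableSpace Ω} {f g : Ω → DataSpace D}
    (hf : Measurable f) (hg : Measurable g) (a b : DataSpace D) :
    Measurable fun ω => Complex.exp ((inner ℝ (f ω) a + inner ℝ (g ω) b : ℝ) * Complex.I) := by
  fun_prop

theorem measurable_gridSum {Ω : Type*} {m : MeasurableSpace Ω} (r : ℝ → ℝ)
    {N : ℝ → Ω → DataSpace D} {t : ℝ} {n k : ℕ} (hN : ∀ i ≤ k, Measurable (N (gridPoint t n i))) :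
    Measurable fun ω => gridSum r (fun v => N v ω) t n k :=
  measurable_sum_smul k _ fun i hi => (hN (i + 1) hi).sub (hN i hi.le)

omit [IsProbabilityMeasure P] in
/-- The joint characteristic function of the initial value and a sum of weighted noise
increments. -/
theorem NoiseSchedule.IsAdmissible.charFun_gridSum (hA : A.IsAdmissible)
    (hX : (A.toSDE D).IsSolution p₀ P X) {t : ℝ} (ht : t ∈ A.time) (r : ℝ → ℝ) (n : ℕ)
    (a b : DataSpace D) (k : ℕ) (hk : k ≤ n) :
    ∫ ω, Complex.exp ((inner ℝ (X 0 ω) a +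
        inner ℝ (gridSum r (fun v => (A.toSDE D).noise X v ω) t n k) b : ℝ) * Complex.I) ∂P =
      charFun p₀ a * Complex.exp (-((∑ i ∈ Finset.range k,
        (∫ v in (gridPoint t n i)..(gridPoint t n (i + 1)), (A.toSDE D).vol v ^ 2) *
          (r (gridPoint t n i)) ^ 2 : ℝ) * ‖b‖ ^ 2) / 2) := by
  have h0 := hA.forward.pos t ht
  induction k with
  | zero =>
    rw [charFun_apply, ← hX.initial_law, integral_map (hX.measurable 0 (mem_insert 0 _)).aemeasurable
      (by fun_prop)]
    simp [gridSum]
  | succ k ih =>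
    have hk' : k < n := hk
    set S := A.toSDE D with hS
    have hmem : ∀ i ≤ n, gridPoint t n i ∈ insert 0 A.time := fun i hi =>
      hA.forward.Icc_subset ht (gridPoint_mem h0.le hi)
    set u := gridPoint t n k with hu
    set w := gridPoint t n (k + 1) with hw
    have huw : u < w := gridPoint_lt_succ h0 hk'
    have hwI : w ∈ A.time := IsForwardTime.mem_of_pos (hmem _ hk)
      ((hA.forward.nonneg (hmem k hk'.le)).trans_lt huw)
    choose! g hgm hge using fun v (hv : v ∈ insert 0 A.time) => hA.noise_ae_eq hX hv
    set Δ : Ω → DataSpace D := fun ω => S.noise X w ω - S.noise X u ω with hΔ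
    have hlaw := hX.noise_law u (hmem k hk'.le) w hwI huw
    have hind := hX.noise_indep u (hmem k hk'.le) w hwI huw
    set Z : Ω → ℂ := fun ω => Complex.exp ((inner ℝ (X 0 ω) a +
      inner ℝ (gridSum r (fun v => S.noise X v ω) t n k) b : ℝ) * Complex.I) with hZ
    -- `Z` with the noise replaced by versions measurable with respect to the uncompleted past,
    -- which is the σ-algebra in `noise_indep`.
    set Z' : Ω → ℂ := fun ω => Complex.exp ((inner ℝ (X 0 ω) a +
      inner ℝ (gridSum r (fun v => g v ω) t n k) b : ℝ) * Complex.I) with hZ'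
    have hZm : Measurable[pastSigma A.time X u] Z' := by
      refine measurable_cexp_inner_add (measurable_pastSigma (mem_insert 0 _)
        (gridPoint_mem h0.le hk'.le).1) (measurable_gridSum r fun i hi => ?_) a b
      exact (hgm _ (hmem i (hi.trans hk'.le))).mono
        (pastSigma_mono (gridPoint_mono h0.le n hi)) le_rfl
    have hZZ : Z =ᵐ[P] Z' := by
      have hall : ∀ᵐ ω ∂P, ∀ i ≤ n, S.noise X (gridPoint t n i) ω = g (gridPoint t n i) ω :=
        ae_all_iff.2 fun i => by
          by_cases hi : i ≤ n
          · filter_upwards [hge _ (hmem i hi)] with ω hω _ using hω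
          · exact .of_forall fun ω h => absurd h hi
      filter_upwards [hall] with ω hω
      have : gridSum r (fun v => S.noise X v ω) t n k = gridSum r (fun v => g v ω) t n k :=
        Finset.sum_congr rfl fun i hi => by
          have hi := Finset.mem_range.1 hi
          simp only
          rw [hω i (hi.le.trans hk'.le), hω (i + 1) (hi.trans hk')]
      simp only [hZ, hZ', this]
    have hindep : IndepFun Z' Δ P := by
      rw [IndepFun_iff_Indep]
      exact indep_of_indep_of_le_left hind hZm.comap_le
    set e : DataSpace D → ℂ := fun z => Complex.exp ((inner ℝ z (r u • b) : ℝ) * Complex.I) with he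
    have hem : Measurable e := by simp only [he]; fun_prop
    have hindep' : IndepFun Z (fun ω => e (Δ ω)) P :=
      (hindep.comp measurable_id hem).congr hZZ.symm .rfl
    have hZae : AEStronglyMeasurable Z P :=
      ((hZm.mono (pastSigma_le hX.measurable u) le_rfl).aestronglyMeasurable).congr hZZ.symm
    have hΔae : AEStronglyMeasurable (fun ω => e (Δ ω)) P :=
      (hem.comp_aemeasurable hlaw.aemeasurable).aestronglyMeasurable
    have hprod := hindep'.integral_fun_mul_eq_mul_integral hZae hΔae
    have hsplit : ∀ ω, Complex.exp ((inner ℝ (X 0 ω) a +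
        inner ℝ (gridSum r (fun v => S.noise X v ω) t n (k + 1)) b : ℝ) * Complex.I) =
        Z ω * e (Δ ω) := by
      intro ω
      simp only [hZ, he, gridSum, Finset.sum_range_succ, ← Complex.exp_add]
      congr 1
      rw [inner_add_left, real_inner_smul_left, real_inner_smul_right]
      push_cast
      ring
    have hev : ∫ ω, e (Δ ω) ∂P =
        Complex.exp (-((∫ v in u..w, S.vol v ^ 2) * (r u) ^ 2 * ‖b‖ ^ 2 : ℝ) / 2) := by
      have hV : 0 ≤ ∫ v in u..w, S.vol v ^ 2 :=
        intervalIntegral.integral_nonneg huw.le fun _ _ => sq_nonneg _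
      have h1 : ∫ ω, e (Δ ω) ∂P = charFun (P.map Δ) (r u • b) := by
        rw [charFun_apply, integral_map hlaw.aemeasurable (by fun_prop)]
      rw [h1, hlaw.map_eq, charFun_map_smul, charFun_stdGaussian]
      congr 1
      rw [norm_smul, norm_smul, Real.norm_eq_abs, Real.norm_eq_abs, abs_of_nonneg (Real.sqrt_nonneg _)]
      norm_cast
      rw [mul_pow, mul_pow, Real.sq_sqrt hV, sq_abs]
      ring_nf
    simp only [hsplit]
    rw [hprod, ih hk'.le, hev, mul_assoc, ← Complex.exp_add, Finset.sum_range_succ]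
    congr 2
    push_cast
    ring

/-- The rescaled increment of a solution of the linear SDE is Gaussian and independent of the
initial value. -/
theorem NoiseSchedule.IsAdmissible.map_initial_increment (hA : A.IsAdmissible)
    (hX : (A.toSDE D).IsSolution p₀ P X) {t : ℝ} (ht : t ∈ A.time) :
    P.map (fun ω => (X 0 ω, (A.scale t)⁻¹ • X t ω - X 0 ω)) =
      p₀.prod ((stdGaussian (DataSpace D)).map fun z => A.sigma t • z) := by
  have hX0 := hX.measurable 0 (mem_insert 0 _)
  have hXt := hX.measurable t (Or.inr ht)
  have hp₀ : IsProbabilityMeasure p₀ :=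
    hX.initial_law ▸ Measure.isProbabilityMeasure_map hX0.aemeasurable
  have hW : Measurable fun ω => (A.scale t)⁻¹ • X t ω - X 0 ω := by
    fun_prop
  have hγ : IsProbabilityMeasure ((stdGaussian (DataSpace D)).map fun z => A.sigma t • z) :=
    Measure.isProbabilityMeasure_map (by fun_prop)
  have hpair : Measurable fun ω => (X 0 ω, (A.scale t)⁻¹ • X t ω - X 0 ω) := hX0.prodMk hW
  have hfin : IsProbabilityMeasure (P.map fun ω => (X 0 ω, (A.scale t)⁻¹ • X t ω - X 0 ω)) :=
    Measure.isProbabilityMeasure_map hpair.aemeasurable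
  -- Factorisation of the joint characteristic function yields both the Gaussian law and the
  -- independence. It holds exactly for the grid sums, up to their variances, and survives the
  -- limit.
  rw [← charFun_eq_prod_iff]
  intro q
  set a := q.ofLp.1 with ha
  set b := q.ofLp.2 with hb
  have hleft : charFun ((P.map fun ω => (X 0 ω, (A.scale t)⁻¹ • X t ω - X 0 ω)).map
      (WithLp.toLp 2)) q = ∫ ω, Complex.exp ((inner ℝ (X 0 ω) a +
        inner ℝ ((A.scale t)⁻¹ • X t ω - X 0 ω) b : ℝ) * Complex.I) ∂P := by
    rw [charFun_apply, Measure.map_map (by fun_prop) hpair, integral_map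
      (Measurable.aemeasurable (Measurable.comp (by fun_prop) hpair)) (by fun_prop)]
    rfl
  rw [hleft, charFun_map_smul, charFun_stdGaussian]
  set r : ℝ → ℝ := fun v => (A.scale v)⁻¹ with hr
  have hlim := tendsto_integral_of_dominated_convergence (μ := P) (fun _ => (1 : ℝ))
    (F := fun n ω => Complex.exp ((inner ℝ (X 0 ω) a +
        inner ℝ (gridSum r (fun v => (A.toSDE D).noise X v ω) t n n) b : ℝ) * Complex.I))
    (f := fun ω => Complex.exp ((inner ℝ (X 0 ω) a +
        inner ℝ ((A.scale t)⁻¹ • X t ω - X 0 ω) b : ℝ) * Complex.I)) ?_ (integrable_const _)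
    (fun n => .of_forall fun ω => (Complex.norm_exp_ofReal_mul_I _).le) ?_
  · simp only [hA.charFun_gridSum hX ht r _ a b _ le_rfl] at hlim
    refine tendsto_nhds_unique hlim ?_
    have hv := hA.tendsto_gridVariance D ht (hX.vol_sq_integrable t ht)
    have hv' := (Complex.continuous_ofReal.tendsto _).comp hv
    have := ((hv'.mul_const ((‖b‖ : ℂ) ^ 2)).neg.div_const 2).cexp.const_mul (charFun p₀ a)
    convert this using 2
    congr 1
    rw [norm_smul, Real.norm_eq_abs]
    norm_cast
    rw [mul_pow, sq_abs]
  · intro n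
    have hN : ∀ i ≤ n, AEMeasurable ((A.toSDE D).noise X (gridPoint t n i)) P := fun i hi => by
      obtain ⟨g, hg, hge⟩ := hA.noise_ae_eq hX
        (hA.forward.Icc_subset ht (gridPoint_mem (hA.forward.pos t ht).le hi))
      exact ⟨g, hg.mono (pastSigma_le hX.measurable _) le_rfl, hge⟩
    have hsum : AEMeasurable (fun ω => gridSum r (fun v => (A.toSDE D).noise X v ω) t n n) P :=
      Finset.aemeasurable_fun_sum _ fun i hi => by
        have h1 := hN (i + 1) (Finset.mem_range.1 hi)
        have h2 := hN i (Finset.mem_range.1 hi).le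
        fun_prop
    have hX0' := hX0.aemeasurable (μ := P)
    exact AEMeasurable.aestronglyMeasurable (by fun_prop)
  · filter_upwards [hX.continuous_paths] with ω hω
    have hc : ContinuousOn (fun v => X v ω) (Icc 0 t) := hω.mono (hA.forward.Icc_subset ht)
    have h := hA.tendsto_gridSum ht hc
    have hcont : Continuous fun y : DataSpace D => Complex.exp ((inner ℝ (X 0 ω) a +
      inner ℝ y b : ℝ) * Complex.I) := by fun_prop
    exact (hcont.tendsto _).comp h

/-- The forward kernel of the linear SDE. -/
theorem NoiseSchedule.IsAdmissible.jointLaw (hA : A.IsAdmissible) [IsProbabilityMeasure p₀]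
    (hX : (A.toSDE D).IsSolution p₀ P X) {t : ℝ} (ht : t ∈ A.time) :
    P.map (fun ω => (X t ω, X 0 ω)) = (noiseData p₀).map fun p =>
      ((A.scale t * A.sigma t) • (p.1 + (A.sigma t)⁻¹ • p.2), p.2) := by
  have hX0 := hX.measurable 0 (mem_insert 0 _)
  have hXt := hX.measurable t (Or.inr ht)
  have hs := (hA.scale_pos t ht).ne'
  have hσ := (hA.sigma_pos ht).ne'
  have h := hA.map_initial_increment hX ht
  have hpair : Measurable fun ω => (X 0 ω, (A.scale t)⁻¹ • X t ω - X 0 ω) :=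
    by fun_prop
  have hG : Measurable fun q : DataSpace D × DataSpace D => (A.scale t • (q.1 + q.2), q.1) := by
    fun_prop
  have h1 := congrArg (Measure.map fun q : DataSpace D × DataSpace D =>
    (A.scale t • (q.1 + q.2), q.1)) h
  rw [Measure.map_map hG hpair, ← Measure.map_id (μ := p₀), Measure.map_prod_map _ _ measurable_id
    (by fun_prop), Measure.map_map hG (by fun_prop)] at h1
  have e1 : ((fun q : DataSpace D × DataSpace D => (A.scale t • (q.1 + q.2), q.1)) ∘
      fun ω => (X 0 ω, (A.scale t)⁻¹ • X t ω - X 0 ω)) = fun ω => (X t ω, X 0 ω) := by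
    funext ω
    simp only [Function.comp, add_sub_cancel, smul_inv_smul₀ hs]
  rw [e1] at h1
  rw [h1, noiseData, ← Measure.prod_swap, Measure.map_map (by fun_prop) measurable_swap]
  congr 1
  funext p
  simp only [Function.comp, Prod.map, id, Prod.swap]
  congr 1
  rw [mul_smul, smul_add (A.sigma t), smul_inv_smul₀ hσ, add_comm]

theorem NoiseSchedule.IsAdmissible.determinesForwardLaw (hA : A.IsAdmissible)
    [IsProbabilityMeasure p₀] : DiffusionSDE.DeterminesForwardLaw.{u} (A.toSDE D) p₀ := by
  intro Ω₁ Ω₂ _ _ P₁ P₂ _ _ X₁ X₂ h₁ h₂ t ht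
  rw [hA.jointLaw h₁ ht, hA.jointLaw h₂ ht]

end LinearSDE

end

/-! ### Entropic times as functions of the noise level. -/

noncomputable section

theorem IsForwardTime.isRegularTimeChange {I : Set ℝ} (hI : IsForwardTime I) {Φ Φ' : ℝ → ℝ}
    (hd : ∀ t ∈ I, HasDerivWithinAt Φ (Φ' t) I t) (hpos : ∀ t ∈ I, 0 < Φ' t) :
    IsRegularTimeChange I Φ where
  continuousOn t ht := (hd t ht).continuousWithinAt
  strictMonoOn := by
    refine strictMonoOn_of_deriv_pos hI.ordConnected.convex
      (fun t ht => (hd t ht).continuousWithinAt) fun t ht => ?_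
    rw [((hd t (interior_subset ht)).hasDerivAt (mem_interior_iff_mem_nhds.1 ht)).deriv]
    exact hpos t (interior_subset ht)
  differentiableOn t ht := (hd t ht).differentiableWithinAt
  deriv_pos t ht := by
    rw [(hd t ht).derivWithin (hI.uniqueDiffOn t ht)]
    exact hpos t ht

/-- The rescaled rate of the entropy with respect to the noise level. -/
def entropyRate {E : Type*} [NormedAddCommGroup E] [InnerProductSpace ℝ E]
    [FiniteDimensional ℝ E] [MeasurableSpace E] [BorelSpace E] (μ : Measure E)
    [IsProbabilityMeasure μ] (σ : ℝ) : ℝ :=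
  posteriorVariance μ σ⁻¹ / σ ^ 2

section EntropyRate

variable {E : Type*} [NormedAddCommGroup E] [InnerProductSpace ℝ E] [FiniteDimensional ℝ E]
  [MeasurableSpace E] [BorelSpace E] (μ : Measure E) [IsProbabilityMeasure μ]

theorem entropyRate_pos (hμ : ∀ a, μ ≠ Measure.dirac a) {σ : ℝ} (hσ : 0 < σ) :
    0 < entropyRate μ σ :=
  div_pos (posteriorVariance_pos μ (inv_pos.2 hσ) hμ) (by positivity)

/-- The bound on `β² V(β)` at `β = 1/σ`, uniform down to `σ = 0`. It makes the rescaled integral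
converge at the initial time, since the factor `σ` cancels the `1/σ` in the entropy derivative. -/
theorem abs_entropyRate_le {σ : ℝ} (hσ : 0 < σ) :
    |entropyRate μ σ| ≤ 2 * ∫ z, ‖z‖ ^ 2 ∂(stdGaussian E) := by
  have h := posteriorVariance_le μ (inv_pos.2 hσ)
  rw [entropyRate, abs_of_nonneg (div_nonneg (posteriorVariance_nonneg μ _) (by positivity)),
    div_eq_inv_mul, ← inv_pow]
  exact h

theorem continuousOn_entropyRate : ContinuousOn (entropyRate μ) (Ioi 0) := by
  have h : ContinuousOn (fun σ : ℝ => posteriorVariance μ σ⁻¹) (Ioi 0) :=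
    (continuousOn_posteriorVariance μ).comp
      (continuousOn_id.inv₀ fun σ (hσ : 0 < σ) => hσ.ne') fun σ (hσ : 0 < σ) => inv_pos.2 hσ
  exact h.div (continuousOn_id.pow 2) fun σ (hσ : 0 < σ) => (pow_pos hσ 2).ne'

theorem integrableOn_entropyRate (b : ℝ) : IntegrableOn (entropyRate μ) (Ioc 0 b) := by
  refine IntegrableOn.of_bound (by simp) (((continuousOn_entropyRate μ).mono
    fun x hx => hx.1).aestronglyMeasurable measurableSet_Ioc)
    (2 * ∫ z, ‖z‖ ^ 2 ∂(stdGaussian E)) ?_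
  exact (ae_restrict_iff' measurableSet_Ioc).2 (.of_forall fun σ hσ => abs_entropyRate_le μ hσ.1)

theorem hasDerivAt_integral_entropyRate {σ : ℝ} (hσ : 0 < σ) :
    HasDerivAt (fun b => ∫ u in (0 : ℝ)..b, entropyRate μ u) (entropyRate μ σ) σ :=
  intervalIntegral.integral_hasDerivAt_right
    ((intervalIntegrable_iff_integrableOn_Ioc_of_le hσ.le).2 (integrableOn_entropyRate μ σ))
    ((continuousOn_entropyRate μ).stronglyMeasurableAtFilter isOpen_Ioi σ hσ)
    ((continuousOn_entropyRate μ).continuousAt (Ioi_mem_nhds hσ))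

end EntropyRate

namespace NoiseSchedule.IsAdmissible

variable {A : NoiseSchedule}

theorem isForwardTime_sigma_image (hA : A.IsAdmissible) : IsForwardTime (A.sigma '' A.time) where
  nonempty := hA.forward.nonempty.image _
  pos := by
    rintro _ ⟨t, ht, rfl⟩
    exact hA.sigma_pos ht
  down := by
    rintro _ ⟨t, ht, rfl⟩ x hx
    obtain ⟨v, hv, rfl⟩ := intermediate_value_Icc (hA.forward.pos t ht).le
      (hA.sigma_continuousOn_Icc ht) (by rw [hA.sigma_zero]; exact ⟨hx.1.le, hx.2⟩)
    refine ⟨v, hA.forward.down t ht ⟨hv.1.lt_of_ne ?_, hv.2⟩, rfl⟩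
    rintro rfl
    exact hx.1.ne' hA.sigma_zero

/-- Treating `σ` itself as a clock makes the substitution rule available for integrals over the
noise level. -/
theorem isClockChange_sigma (hA : A.IsAdmissible) :
    IsClockChange A.time (A.sigma '' A.time) A.sigma :=
  ⟨hA.forward, hA.isForwardTime_sigma_image,
    hA.sigma_strictMonoOn.mono (subset_insert _ _), rfl, hA.sigma_differentiableOn⟩

theorem integral_rate (hA : A.IsAdmissible) {t : ℝ} (ht : t ∈ A.time) :
    ∫ r in (0 : ℝ)..t, derivWithin A.scale A.time r / A.scale r = Real.log (A.scale t) := by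
  have h0 := (hA.forward.pos t ht).le
  have h := intervalIntegral.integral_eq_sub_of_hasDerivAt_of_le h0
    (f := fun r => Real.log (A.scale r)) ((hA.scale_continuousOn_Icc ht).log fun v hv =>
      (hA.scale_pos' (hA.forward.Icc_subset ht hv)).ne') (fun r hr =>
      (hA.hasDerivAt_scale ht hr).log (hA.scale_pos r (hA.forward.down t ht
        ⟨hr.1, hr.2.le⟩)).ne') (hA.intervalIntegrable_rate ht)
  rw [h, hA.scale_zero, Real.log_one, sub_zero]

variable {A' : NoiseSchedule} {D : ℕ} {φ : ℝ → ℝ}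

/-- Equivalent linear SDEs have the same scale at corresponding times. -/
theorem scale_comp_eq [Nontrivial (DataSpace D)] (hA : A.IsAdmissible) (hA' : A'.IsAdmissible)
    (hφ : (A.toSDE D).EquivVia (A'.toSDE D) φ) {t : ℝ} (ht : t ∈ A.time) :
    A'.scale (φ t) = A.scale t := by
  have hc : IsClockChange A.time A'.time φ := hφ.isClockChange hA.forward hA'.forward
  -- A single nonzero state reads off the scalar coefficient of the linear drift.
  obtain ⟨x, hx⟩ := exists_ne (0 : DataSpace D)
  have hrate : ∀ v ∈ A.time, derivWithin φ A.time v •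
      (derivWithin A'.scale A'.time (φ v) / A'.scale (φ v)) =
      derivWithin A.scale A.time v / A.scale v := fun v hv => by
    have h := hφ.drift_eq x v hv
    simp only [NoiseSchedule.toSDE, smul_smul] at h
    exact smul_left_injective ℝ hx h
  have h0 := hA.forward.pos t ht
  have hint := hc.integral_eq (mem_insert 0 _) ht h0.le
    (fun s => derivWithin A'.scale A'.time s / A'.scale s)
  rw [fromZero_zero, hA'.integral_rate (hc.mapsTo ht)] at hint
  have hcongr : ∫ v in (0 : ℝ)..t, derivWithin φ A.time v •
      (derivWithin A'.scale A'.time (φ v) / A'.scale (φ v)) = Real.log (A.scale t) := by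
    rw [← hA.integral_rate ht]
    refine intervalIntegral.integral_congr_ae (.of_forall fun v hv => ?_)
    rw [uIoc_of_le h0.le] at hv
    exact hrate v (hA.forward.down t ht hv)
  exact Real.log_injOn_pos (hA'.scale_pos _ (hc.mapsTo ht)) (hA.scale_pos t ht)
    (hint.trans hcongr)

/-- Equivalent linear SDEs have the same noise level at corresponding times. -/
theorem sigma_comp_eq [Nontrivial (DataSpace D)] (hA : A.IsAdmissible) (hA' : A'.IsAdmissible)
    (hφ : (A.toSDE D).EquivVia (A'.toSDE D) φ) {t : ℝ} (ht : t ∈ A.time) :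
    A'.sigma (φ t) = A.sigma t := by
  have hc : IsClockChange A.time A'.time φ := hφ.isClockChange hA.forward hA'.forward
  have h0 := hA.forward.pos t ht
  have hint := hc.integral_eq (mem_insert 0 _) ht h0.le
    (fun s => (A'.toSDE D).vol s ^ 2 * ((A'.scale s)⁻¹) ^ 2)
  rw [fromZero_zero, hA'.integral_vol_sq_div D (hc.mapsTo ht)] at hint
  have hcongr : ∫ v in (0 : ℝ)..t, derivWithin φ A.time v •
      ((A'.toSDE D).vol (φ v) ^ 2 * ((A'.scale (φ v))⁻¹) ^ 2) = A.sigma t ^ 2 := by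
    rw [← hA.integral_vol_sq_div D ht]
    refine intervalIntegral.integral_congr_ae (.of_forall fun v hv => ?_)
    rw [uIoc_of_le h0.le] at hv
    have hv := hA.forward.down t ht hv
    rw [smul_eq_mul, ← mul_assoc, hA.scale_comp_eq hA' hφ hv]
    congr 1
    exact hφ.vol_sq hv
  exact (pow_left_inj₀ (hA'.sigma_pos (hc.mapsTo ht)).le (hA.sigma_pos ht).le two_ne_zero).1
    (hint.trans hcongr)

variable {Ω : Type u} [MeasurableSpace Ω] {P : Measure Ω} [IsProbabilityMeasure P]
  {p₀ : Measure (DataSpace D)} [IsProbabilityMeasure p₀] {X : ℝ → Ω → DataSpace D}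
  {ρ : Measure (DataSpace D)} [SigmaFinite ρ]

theorem entropicTime_eq_sub_integral (hA : A.IsAdmissible)
    (hX : (A.toSDE D).IsSolution p₀ P X)
    (hH : ∀ t ∈ A.time, HasCondEntropy ρ P (X 0) (X t)) {t v : ℝ} (ht : t ∈ A.time)
    (hv : v ∈ A.time) : entropicTime ρ P X v = entropicTime ρ P X t -
      ∫ β in (A.sigma t)⁻¹..(A.sigma v)⁻¹, β * posteriorVariance p₀ β := by
  have hX0 := hX.measurable 0 (mem_insert 0 _)
  have key : ∀ t ∈ A.time, ∀ v ∈ A.time, v ≤ t → entropicTime ρ P X v - entropicTime ρ P X t =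
      -∫ β in (A.sigma t)⁻¹..(A.sigma v)⁻¹, β * posteriorVariance p₀ β := by
    intro t ht v hv hvt
    have hσ := hA.sigma_strictMonoOn.monotoneOn (Or.inr hv) (Or.inr ht) hvt
    have hc : ∀ r ∈ A.time, A.scale r * A.sigma r ≠ 0 := fun r hr =>
      (mul_pos (hA.scale_pos r hr) (hA.sigma_pos hr)).ne'
    exact condEntropy_sub_condEntropy (inv_pos.2 (hA.sigma_pos ht))
      (inv_anti₀ (hA.sigma_pos hv) hσ) (hc t ht) (hc v hv) hX0 hX0 (hA.jointLaw hX ht)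
      (hA.jointLaw hX hv) (hH t ht) (hH v hv)
  rcases le_total v t with h | h
  · have := key t ht v hv h
    linarith
  · have := key v hv t ht h
    rw [intervalIntegral.integral_symm] at this
    linarith

/-- Chain rule with `β = 1/σ`: the rate `-β V(β)` times `-σ'/σ²`. The integral is based at the point
of differentiation, so only local continuity of `V` enters. -/
theorem hasDerivWithinAt_entropicTime (hA : A.IsAdmissible)
    (hX : (A.toSDE D).IsSolution p₀ P X)
    (hH : ∀ t ∈ A.time, HasCondEntropy ρ P (X 0) (X t)) {t : ℝ} (ht : t ∈ A.time) :
    HasDerivWithinAt (entropicTime ρ P X)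
      (derivWithin A.sigma A.time t * (entropyRate p₀ (A.sigma t) / A.sigma t)) A.time t := by
  have hσ := hA.sigma_pos ht
  have hβ : 0 < (A.sigma t)⁻¹ := inv_pos.2 hσ
  have hcont : ContinuousOn (fun β => β * posteriorVariance p₀ β) (Ioi 0) :=
    continuousOn_id.mul (continuousOn_posteriorVariance p₀)
  have h1 : HasDerivAt (fun b => ∫ β in (A.sigma t)⁻¹..b, β * posteriorVariance p₀ β)
      ((A.sigma t)⁻¹ * posteriorVariance p₀ (A.sigma t)⁻¹) (A.sigma t)⁻¹ :=
    intervalIntegral.integral_hasDerivAt_right IntervalIntegrable.refl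
      (hcont.stronglyMeasurableAtFilter isOpen_Ioi _ hβ) (hcont.continuousAt (Ioi_mem_nhds hβ))
  have h2 := (hA.sigma_differentiableOn t ht).hasDerivWithinAt.inv hσ.ne'
  have h3 := (h1.comp_hasDerivWithinAt t h2).const_sub (entropicTime ρ P X t)
  refine (h3.congr_deriv ?_).congr (fun v hv => hA.entropicTime_eq_sub_integral hX hH ht hv)
    (hA.entropicTime_eq_sub_integral hX hH ht ht)
  rw [entropyRate]
  field_simp

theorem isRegularTimeChange_entropicTime (hA : A.IsAdmissible)
    (hX : (A.toSDE D).IsSolution p₀ P X)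
    (hH : ∀ t ∈ A.time, HasCondEntropy ρ P (X 0) (X t)) (hp₀ : ∀ a, p₀ ≠ Measure.dirac a) :
    IsRegularTimeChange A.time (entropicTime ρ P X) :=
  hA.forward.isRegularTimeChange (fun _ ht => hA.hasDerivWithinAt_entropicTime hX hH ht)
    fun t ht => mul_pos (hA.sigma_deriv_pos t ht)
      (div_pos (entropyRate_pos p₀ hp₀ (hA.sigma_pos ht)) (hA.sigma_pos ht))

theorem rescaledRate_eq (hA : A.IsAdmissible) (hX : (A.toSDE D).IsSolution p₀ P X)
    (hH : ∀ t ∈ A.time, HasCondEntropy ρ P (X 0) (X t)) {t : ℝ} (ht : t ∈ A.time) :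
    A.rescaledRate (entropicTime ρ P X) t =
      derivWithin A.sigma A.time t • entropyRate p₀ (A.sigma t) := by
  rw [NoiseSchedule.rescaledRate, (hA.hasDerivWithinAt_entropicTime hX hH ht).derivWithin
    (hA.forward.uniqueDiffOn t ht), smul_eq_mul]
  have := (hA.sigma_pos ht).ne'
  field_simp

theorem integrableOn_rescaledRate (hA : A.IsAdmissible) (hX : (A.toSDE D).IsSolution p₀ P X)
    (hH : ∀ t ∈ A.time, HasCondEntropy ρ P (X 0) (X t)) {t : ℝ} (ht : t ∈ A.time) :
    IntegrableOn (A.rescaledRate (entropicTime ρ P X)) (Ioc 0 t) := by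
  have h := (hA.isClockChange_sigma.integrableOn_Ioc_iff (mem_insert 0 _) ht (entropyRate p₀)).1
    (by rw [fromZero_zero]; exact integrableOn_entropyRate p₀ _)
  exact h.congr_fun (fun v hv => (hA.rescaledRate_eq hX hH (hA.forward.down t ht hv)).symm)
    measurableSet_Ioc

/-- The rescaled time depends on the schedule only through the current noise level, so equal noise
levels give equal rescaled times. -/
theorem rescaledTime_eq (hA : A.IsAdmissible) (hX : (A.toSDE D).IsSolution p₀ P X)
    (hH : ∀ t ∈ A.time, HasCondEntropy ρ P (X 0) (X t)) {t : ℝ} (ht : t ∈ A.time) :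
    A.rescaledTime (entropicTime ρ P X) t = ∫ u in (0 : ℝ)..(A.sigma t), entropyRate p₀ u := by
  have h0 := (hA.forward.pos t ht).le
  have h := hA.isClockChange_sigma.integral_eq (mem_insert 0 _) ht h0 (entropyRate p₀)
  rw [fromZero_zero] at h
  rw [h, NoiseSchedule.rescaledTime]
  refine intervalIntegral.integral_congr_ae (.of_forall fun v hv => ?_)
  rw [uIoc_of_le h0] at hv
  exact hA.rescaledRate_eq hX hH (hA.forward.down t ht hv)

theorem isRegularTimeChange_rescaledTime (hA : A.IsAdmissible)
    (hX : (A.toSDE D).IsSolution p₀ P X)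
    (hH : ∀ t ∈ A.time, HasCondEntropy ρ P (X 0) (X t)) (hp₀ : ∀ a, p₀ ≠ Measure.dirac a) :
    IsRegularTimeChange A.time (A.rescaledTime (entropicTime ρ P X)) := by
  refine hA.forward.isRegularTimeChange
    (Φ' := fun t => entropyRate p₀ (A.sigma t) * derivWithin A.sigma A.time t)
    (fun t ht => ?_) fun t ht =>
      mul_pos (entropyRate_pos p₀ hp₀ (hA.sigma_pos ht)) (hA.sigma_deriv_pos t ht)
  exact ((hasDerivAt_integral_entropyRate p₀ (hA.sigma_pos ht)).comp_hasDerivWithinAt t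
    (hA.sigma_differentiableOn t ht).hasDerivWithinAt).congr
    (fun v hv => hA.rescaledTime_eq hX hH hv) (hA.rescaledTime_eq hX hH ht)

end NoiseSchedule.IsAdmissible

end

/-! ### Assembly. -/

theorem mainTheorem1 {D : ℕ} (S S' : DiffusionSDE D) (φ : ℝ → ℝ)
    (hS : IsForwardTime S.time) (hS' : IsForwardTime S'.time) (hφ : S.EquivVia S' φ)
    (p₀ : Measure (DataSpace D)) [IsProbabilityMeasure p₀]
    (ρ : Measure (DataSpace D)) [SigmaFinite ρ]
    {Ω Ω' : Type u} [MeasurableSpace Ω] [MeasurableSpace Ω']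
    (P : Measure Ω) [IsProbabilityMeasure P] (P' : Measure Ω') [IsProbabilityMeasure P']
    (X : ℝ → Ω → DataSpace D) (Y : ℝ → Ω' → DataSpace D)
    (hX : S.IsSolution p₀ P X) (hY : S'.IsSolution p₀ P' Y)
    (hfin : ∀ t ∈ S.time, HasCondEntropy ρ P (X 0) (X t)) :
    -- arbitrary drift and volatility, as long as the SDE determines its forward kernel
    (DiffusionSDE.DeterminesForwardLaw.{u} S p₀ →
      (∀ t ∈ S.time, HasCondEntropy ρ P' (Y 0) (Y (φ t)) ∧
        entropicTime ρ P' Y (φ t) = entropicTime ρ P X t) ∧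
      (IsProperTimeChange S.time (entropicTime ρ P X) →
        IsProperTimeChange S'.time (entropicTime ρ P' Y) ∧
        TransitionIsIdentity S.time S'.time φ (entropicTime ρ P X) (entropicTime ρ P' Y)) ∧
      (IsRegularTimeChange S.time (entropicTime ρ P X) →
        IsRegularTimeChange S'.time (entropicTime ρ P' Y) →
        SameInNewTimes S S' φ (entropicTime ρ P X) (entropicTime ρ P' Y))) ∧
    -- SDEs given by a scale and a noise level, data not concentrated at one point
    (∀ A A' : NoiseSchedule, A.IsAdmissible → A'.IsAdmissible →
      S = A.toSDE D → S' = A'.toSDE D → (∀ a, p₀ ≠ Measure.dirac a) →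
      -- entropic time
      (IsRegularTimeChange S.time (entropicTime ρ P X) ∧
        IsRegularTimeChange S'.time (entropicTime ρ P' Y) ∧
        TransitionIsIdentity S.time S'.time φ (entropicTime ρ P X) (entropicTime ρ P' Y) ∧
        SameInNewTimes S S' φ (entropicTime ρ P X) (entropicTime ρ P' Y)) ∧
      -- rescaled entropic time
      ((∀ t ∈ S.time,
          IntegrableOn (A.rescaledRate (entropicTime ρ P X)) (Ioc 0 t)) ∧
        (∀ t ∈ S'.time,
          IntegrableOn (A'.rescaledRate (entropicTime ρ P' Y)) (Ioc 0 t)) ∧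
        IsRegularTimeChange S.time (A.rescaledTime (entropicTime ρ P X)) ∧
        IsRegularTimeChange S'.time (A'.rescaledTime (entropicTime ρ P' Y)) ∧
        TransitionIsIdentity S.time S'.time φ (A.rescaledTime (entropicTime ρ P X))
          (A'.rescaledTime (entropicTime ρ P' Y)) ∧
        SameInNewTimes S S' φ (A.rescaledTime (entropicTime ρ P X))
          (A'.rescaledTime (entropicTime ρ P' Y)))) := by
  have hc := hφ.isClockChange hS hS'
  have hX0 := hX.measurable 0 (mem_insert 0 _)
  have hY0 := hY.measurable 0 (mem_insert 0 _)
  have hmain : DiffusionSDE.DeterminesForwardLaw.{u} S p₀ → ∀ t ∈ S.time,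
      HasCondEntropy ρ P' (Y 0) (Y (φ t)) ∧
        entropicTime ρ P' Y (φ t) = entropicTime ρ P X t := fun hd t ht =>
    have hJ := hφ.jointLaw_eq hc hd hX hY ht
    ⟨(hfin t ht).of_jointLaw hX0 hY0 hJ, (condEntropy_eq_of_jointLaw ρ hX0 hY0 hJ).symm⟩
  refine ⟨fun hd => ⟨hmain hd, fun hΦ => ?_, fun hΦ hΨ => ?_⟩, ?_⟩
  · exact ⟨hc.isProperTimeChange hΦ fun t ht => (hmain hd t ht).2,
      hΦ.transitionIsIdentity hc.image_eq fun t ht => (hmain hd t ht).2⟩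
  · exact hφ.sameInNewTimes hc hΦ hΨ fun t ht => (hmain hd t ht).2
  rintro A A' hA hA' rfl rfl hp₀
  -- In dimension `0` every probability measure is a point mass, which is excluded.
  have hnt : Nontrivial (DataSpace D) := by
    by_contra h
    rw [not_nontrivial_iff_subsingleton] at h
    refine hp₀ 0 ?_
    have : (id : DataSpace D → DataSpace D) = fun _ => 0 := funext fun _ => Subsingleton.elim _ _
    rw [← Measure.map_id (μ := p₀), this, Measure.map_const]
    simp
  have heq := hmain hA.determinesForwardLaw
  -- Finiteness is assumed for `X` only; it reaches every time of `Y` because `φ` is onto.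
  have hfin' : ∀ s ∈ A'.time, HasCondEntropy ρ P' (Y 0) (Y s) := fun s hs => by
    obtain ⟨t, ht, rfl⟩ := hc.exists_eq hs
    exact (heq t ht).1
  have hΦ := hA.isRegularTimeChange_entropicTime hX hfin hp₀
  have hΨ := hA'.isRegularTimeChange_entropicTime hY hfin' hp₀
  have hR := hA.isRegularTimeChange_rescaledTime hX hfin hp₀
  have hR' := hA'.isRegularTimeChange_rescaledTime hY hfin' hp₀
  have hReq : ∀ t ∈ A.time, A'.rescaledTime (entropicTime ρ P' Y) (φ t) =
      A.rescaledTime (entropicTime ρ P X) t := fun t ht => by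
    rw [hA'.rescaledTime_eq hY hfin' (hc.mapsTo ht), hA.rescaledTime_eq hX hfin ht,
      hA.sigma_comp_eq hA' hφ ht]
  exact ⟨⟨hΦ, hΨ, hΦ.transitionIsIdentity hc.image_eq fun t ht => (heq t ht).2,
      hφ.sameInNewTimes hc hΦ hΨ fun t ht => (heq t ht).2⟩,
    fun t ht => hA.integrableOn_rescaledRate hX hfin ht,
    fun t ht => hA'.integrableOn_rescaledRate hY hfin' ht, hR, hR',
    hR.transitionIsIdentity hc.image_eq hReq, hφ.sameInNewTimes hc hR hR' hReq⟩
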